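/- **Setting.** Vectors are over $\mathbb F_2$, $|\cdot|$ is the Hamming weight and an $[n,k]$-code is a $k$-dimensional subspace of $\mathbb F_2^n$. Let $k,t,s,k_{\rm aux},t_{\rm aux},w,u,N_{\rm aux},N_{\rm iter}$ be functions of $n$ with, for all large $n$, $k_{\rm aux}\le s\le k\le n$, $u\le t$, $t-u\le s$, $u\le n-s$. Let $K_w^{(m)}(x)=\sum_{j=0}^w(-1)^j\binom xj\binom{m-x}{w-j}$ and $$\delta=\frac{K_w^{(n-s)}(u)\,K_{t_{\rm aux}}^{(s)}(t-u)}{\binom{n-s}{w}\binom{s}{t_{\rm aux}}},\qquad \widetilde H=\frac{\binom{n-s}{w}\binom{s}{t_{\rm aux}}}{2^{k-k_{\rm aux}}}.$$ **The double-RLPN decoder**, on input a code $\mathcal C$ and $\mathbf y\in\mathbb F_2^n$, performs $N_{\rm iter}$ iterations. Each draws uniformly and independently a set $\mathscr N\subseteq\{1,\dots,n\}$ of size $n-s$, with complement $\mathscr P$, and $[s,k_{\rm aux}]$-codes $\mathcal C_{\rm aux}^{(1)},\dots,\mathcal C_{\rm aux}^{(N_{\rm aux})}$, with generator matrices $\mathbf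 G^{(j)}$. For each $j$ it computes the set $\mathscr H^{(j)}$ of all $(\mathbf h,\mathbf c)\in\mathcal C^\perp\times\mathcal C_{\rm aux}^{(j)}$ with $|\mathbf h_{\mathscr N}|=w$ and $|\mathbf h_{\mathscr P}+\mathbf c|=t_{\rm aux}$, the function $f^{(j)}(\mathbf v)=\sum_{\mathbf h:(\mathbf h,\mathbf v\mathbf G^{(j)})\in\mathscr H^{(j)}}(-1)^{\langle\mathbf y,\mathbf h\rangle}$ on $\mathbb F_2^{k_{\rm aux}}$, its Fourier transform $\widehat{f^{(j)}}(\mathbf x)=\sum_{\mathbf v}f^{(j)}(\mathbf v)(-1)^{\langle\mathbf x,\mathbf v\rangle}$, and the set of candidates $\mathscr S^{(j)}=\{\mathbf x:\widehat{f^{(j)}}(\mathbf x)\ge\frac\delta2\widetilde H\}$. Then, for every tuple $(\mathbf s^{(j)})_j\in\prod_j\mathscr S^{(j)}$ and every $\mathbf v\in\mathbb F_2^s$ with $|\mathbf v|=t-u$ and $\mathbf G^{(j)}\mathbf v^{\top}=(\mathbf s^{(j)})^{\top}$ for all $j$, it calls a routine that returns one vector $\mathbf e'$ with $\mathbf y-\mathbf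 e'\in\mathcal C$, $\mathbf e'_{\mathscr P}=\mathbf v$ and $|\mathbf e'_{\mathscr N}|=u$, if there is one. The vectors so returned are the vectors *found* in the iteration; the first of them is the vector *returned* by the iteration. **Statement.** Let $\mathcal C$ be uniform among the $[n,k]$-codes, independently of the choices above, $\mathbf e\in\mathbb F_2^n$ a fixed vector of weight $t$, and $\mathbf y=\mathbf c+\mathbf e$ with $\mathbf c\in\mathcal C$ (chosen in any way as a function of $\mathcal C$). Suppose that $\delta>0$ for all large $n$, that for some constant $\alpha>0$ $$\widetilde H=\omega\Big(\frac{n^{\alpha+8}}{\delta^2}\Big),\qquad \frac{\binom{n-s}{w}\binom{s}{t_{\rm aux}}}{2^k}=O(n^\alpha),\qquad \frac{\binom{s}{t_{\rm aux}}}{2^{s-k_{\rm aux}}}=O(n^\alpha),$$ that $N_{\rm iter}=\omega\Big(\frac{\binom nt}{\binom s{t-u}\binom{n-s}u}\Big)$ and that $N_{\rm aux}=O(1)$. Then, as $n\to\infty$: 1. with probability $1-o(1)$, $\mathbf e$ is among the vectors found by the decoder; 2. if moreover $\binom{s}{t-u}\binom{n-s}{u}=o(2^{n-k})$, then with probability $1-o(1)$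 some iteration returns $\mathbf e$; 3. if moreover $\binom nt=o(2^{n-k})$ (so that $\mathbf e$ is, with probability $1-o(1)$, the only solution of the decoding problem), then with probability $1-o(1)$ the first vector returned by any iteration is $\mathbf e$. -/

import Mathlib

open Filter Topology Asymptotics

noncomputable section

namespace DoubleRLPN

/-- Binary vectors of length `n`. -/
abbrev Vec (n : ℕ) : Type := Fin n → ZMod 2

/-- Binary linear `[n, k]`-codes. -/
abbrev Code (n k : ℕ) : Type :=
  {C : Submodule (ZMod 2) (Vec n) // Module.finrank (ZMod 2) C = k}

/-- The probability of the event `E` under the uniform distribution on the finite set `Ω`. -/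
def prob (Ω : Type) (E : Ω → Prop) : ℝ :=
  (Nat.card {ω : Ω // E ω} : ℝ) / (Nat.card Ω : ℝ)

/-- `f = ω(g)`, that is `|f| / g → ∞`. -/
def IsLittleOmega (f g : ℕ → ℝ) : Prop :=
  Tendsto (fun n => |f n| / g n) atTop atTop

/-- The sign `(-1)^a` of a bit. -/
def sgn (a : ZMod 2) : ℝ := (-1 : ℝ) ^ a.val

/-- The Krawtchouk polynomial `K_w^{(m)}`, evaluated at an integer `0 ≤ x ≤ m`. -/
def krawtchouk (m w x : ℕ) : ℝ :=
  ∑ j ∈ Finset.range (w + 1),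
    (-1 : ℝ) ^ j * (x.choose j : ℝ) * ((m - x).choose (w - j) : ℝ)

/-- The Fourier transform of a real function on `𝔽₂^m`. -/
def fourier {m : ℕ} (f : Vec m → ℝ) (x : Vec m) : ℝ :=
  ∑ v : Vec m, f v * sgn (x ⬝ᵥ v)

/-- The parameters of the decoder, for a given code length `n`. -/
structure Params where
  /-- dimension of the code to decode -/
  k : ℕ
  /-- weight of the error -/
  t : ℕ
  /-- number of positions in `𝒫` -/
  s : ℕ
  /-- dimension of the auxiliary codes -/
  kAux : ℕ
  /-- decoding distance in the auxiliary codes -/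
  tAux : ℕ
  /-- weight on `𝒩` of the parity-checks -/
  w : ℕ
  /-- weight on `𝒩` on which the decoder bets for the error -/
  u : ℕ
  /-- number of auxiliary codes per iteration -/
  nAux : ℕ
  /-- number of iterations -/
  nIter : ℕ

/-- The expected bias `δ`. -/
def delta (n : ℕ) (q : Params) : ℝ :=
  krawtchouk (n - q.s) q.w q.u * krawtchouk q.s q.tAux (q.t - q.u) /
    (((n - q.s).choose q.w : ℝ) * (q.s.choose q.tAux : ℝ))

/-- The expected number `binom(n-s, w) binom(s, t_aux) / 2^(k - k_aux)` of LPN samples. -/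
def expSamples (n : ℕ) (q : Params) : ℝ :=
  ((n - q.s).choose q.w : ℝ) * (q.s.choose q.tAux : ℝ) / (2 : ℝ) ^ ((q.k : ℤ) - (q.kAux : ℤ))

/-- The quantity `binom(n, t) / (binom(s, t-u) binom(n-s, u))`. -/
def expIter (n : ℕ) (q : Params) : ℝ :=
  (n.choose q.t : ℝ) / ((q.s.choose (q.t - q.u) : ℝ) * ((n - q.s).choose q.u : ℝ))

/-- The ranges in which the parameters make sense: codes of the given dimensions exist, the code
to decode can have full rank on `s` positions, and an error of weight `t` can have weight `u` on
`n - s` positions and `t - u` on the other `s`. -/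
def Admissible (n : ℕ) (q : Params) : Prop :=
  q.kAux ≤ q.s ∧ q.s ≤ q.k ∧ q.k ≤ n ∧ q.u ≤ q.t ∧ q.t - q.u ≤ q.s ∧ q.u ≤ n - q.s

/-- The asymptotic constraints on the parameters, as functions of the length `n`. -/
def ParameterConstraint (p : ℕ → Params) : Prop :=
  ∃ α : ℝ, 0 < α ∧
    IsLittleOmega (fun n => expSamples n (p n))
      (fun n => (n : ℝ) ^ (α + 8) / delta n (p n) ^ 2) ∧
    (fun n : ℕ => ((n - (p n).s).choose (p n).w : ℝ) * ((p n).s.choose (p n).tAux : ℝ) /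
      (2 : ℝ) ^ (p n).k) =O[atTop] (fun n : ℕ => (n : ℝ) ^ α) ∧
    (fun n : ℕ => ((p n).s.choose (p n).tAux : ℝ) /
      (2 : ℝ) ^ (((p n).s : ℤ) - ((p n).kAux : ℤ))) =O[atTop] (fun n : ℕ => (n : ℝ) ^ α)

/-- The sets `𝒩` of `n - s` positions among `n`. -/
abbrev PosSet (n s : ℕ) : Type := {N : Finset (Fin n) // N.card + s = n}

theorem card_compl_posSet {n s : ℕ} (N : PosSet n s) : (N.1ᶜ).card = s := by
  have h := N.2
  rw [Finset.card_compl, Fintype.card_fin]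
  omega

/-- The restriction `x_𝒫` of `x` to the complement `𝒫` of `𝒩`, whose `s` positions are listed in
increasing order. -/
def restrictP {n s : ℕ} (N : PosSet n s) (x : Vec n) : Vec s :=
  fun j => x ((N.1ᶜ).orderEmbOfFin (card_compl_posSet N) j)

open Classical in
/-- The weight `|x_𝒩|` of `x` on the positions in `𝒩`. -/
def weightN {n s : ℕ} (N : PosSet n s) (x : Vec n) : ℕ :=
  (N.1.filter fun i => x i ≠ 0).card

/-- A generator matrix of a code (its rows are an arbitrarily chosen basis of the code). -/
def genMatrix {m l : ℕ} (A : Code m l) : Matrix (Fin l) (Fin m) (ZMod 2) :=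
  Matrix.of fun i => ((Module.finBasisOfFinrankEq (ZMod 2) A.1 A.2 i : A.1) : Vec m)

/-! ### The subroutines -/

open Classical in
/-- `ParityCheckEquations(w, 𝒩, C)`: all the parity-checks of `C` of weight `w` on `𝒩`. -/
def parityCheckEquations {n s k : ℕ} (w : ℕ) (N : PosSet n s) (C : Code n k) : Finset (Vec n) :=
  Finset.univ.filter fun h => (∀ c ∈ C.1, c ⬝ᵥ h = 0) ∧ weightN N h = w

open Classical in
/-- `Decode(z, A, τ)`: all the codewords of `A` at distance `τ` from `z`. -/
def decode {m l : ℕ} (z : Vec m) (A : Code m l) (τ : ℕ) : Finset (Vec m) :=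
  Finset.univ.filter fun c => c ∈ A.1 ∧ hammingNorm (z + c) = τ

open Classical in
/-- `LPN-Samples`: the set `ℋ` of the pairs `(h, c_aux)`, for an auxiliary code `A`. -/
def lpnSamples {n : ℕ} (q : Params) (C : Code n q.k) (N : PosSet n q.s) (A : Code q.s q.kAux) :
    Finset (Vec n × Vec q.s) :=
  (parityCheckEquations q.w N C).biUnion fun h => {h} ×ˢ decode (restrictP N h) A q.tAux

open Classical in
/-- The function `f_{y, ℋ, G}` on `𝔽₂^l`. -/
def lpnFun {n m l : ℕ} (y : Vec n) (H : Finset (Vec n × Vec m))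
    (G : Matrix (Fin l) (Fin m) (ZMod 2)) (v : Vec l) : ℝ :=
  ∑ h ∈ Finset.univ.filter (fun h : Vec n => (h, Matrix.vecMul v G) ∈ H), sgn (y ⬝ᵥ h)

open Classical in
/-- `FFT-Decode`: the set `𝒮` of candidates for `e_𝒫 Gᵀ`. -/
def fftDecode {n : ℕ} (q : Params) (y : Vec n) (H : Finset (Vec n × Vec q.s))
    (G : Matrix (Fin q.kAux) (Fin q.s) (ZMod 2)) : Finset (Vec q.kAux) :=
  Finset.univ.filter fun x => delta n q / 2 * expSamples n q ≤ fourier (lpnFun y H G) x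

open Classical in
/-- `Decode-Dumer(H, σ, τ)`: a list of all the solutions `v` of `H vᵀ = σᵀ` with `|v| = τ`. -/
def decodeDumer {ι : Type} {m : ℕ} (H : Matrix ι (Fin m) (ZMod 2)) (σ : ι → ZMod 2) (τ : ℕ) :
    List (Vec m) :=
  (Finset.univ.filter fun v : Vec m => H.mulVec v = σ ∧ hammingNorm v = τ).toList

open Classical in
/-- `Solve-SubProblem(C, 𝒩, y, v, u)`: some `e` with `y - e ∈ C`, `e_𝒫 = v` and `|e_𝒩| = u`,
or `none` when there is no such vector. -/
def solveSubProblem {n s k : ℕ} (C : Code n k) (N : PosSet n s) (y : Vec n) (v : Vec s) (u : ℕ) :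
    Option (Vec n) :=
  if h : ∃ e : Vec n, y - e ∈ C.1 ∧ restrictP N e = v ∧ weightN N e = u then
    some h.choose
  else none

/-- The results different from `⊥` of the successive calls to `Solve-SubProblem` in `Recover-e`,
when both loops (on the tuples of candidates, then on the solutions of the decoding problem for
the stacked matrix) are run to their end. -/
def recoverAll {n : ℕ} (q : Params) (y : Vec n) (C : Code n q.k) (N : PosSet n q.s)
    (S : Fin q.nAux → Finset (Vec q.kAux))
    (G : Fin q.nAux → Matrix (Fin q.kAux) (Fin q.s) (ZMod 2)) : List (Vec n) :=
  (Fintype.piFinset S).toList.flatMap fun σ =>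
    (decodeDumer (Matrix.of fun r : Fin q.nAux × Fin q.kAux => G r.1 r.2)
      (fun r => σ r.1 r.2) (q.t - q.u)).filterMap fun v => solveSubProblem C N y v q.u

/-! ### The decoder -/

/-- The random choices of one iteration: the set `𝒩` and the auxiliary codes. -/
abbrev Iter (n : ℕ) (q : Params) : Type :=
  PosSet n q.s × (Fin q.nAux → Code q.s q.kAux)

/-- The code to decode, together with the random choices of all the iterations. Under the uniform
distribution on this product all of these are uniform and independent. -/
abbrev Run (n : ℕ) (q : Params) : Type :=
  Code n q.k × (Fin q.nIter → Iter n q)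

/-- All the error vectors found in one iteration. -/
def foundErrors {n : ℕ} (q : Params) (y : Vec n) (C : Code n q.k) (ρ : Iter n q) :
    List (Vec n) :=
  recoverAll q y C ρ.1
    (fun j => fftDecode q y (lpnSamples q C ρ.1 (ρ.2 j)) (genMatrix (ρ.2 j)))
    (fun j => genMatrix (ρ.2 j))

/-- The value returned by `Recover-e` in one iteration: the first error vector that is found. -/
def recoverE {n : ℕ} (q : Params) (y : Vec n) (C : Code n q.k) (ρ : Iter n q) :
    Option (Vec n) :=
  (foundErrors q y C ρ).head?

/-- The value returned by the decoder when it stops at the first iteration in which `Recover-e`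
returns a vector. -/
def decoderOutput {n : ℕ} (q : Params) (y : Vec n) (ω : Run n q) : Option (Vec n) :=
  (List.finRange q.nIter).findSome? fun i => recoverE q y ω.1 (ω.2 i)

end DoubleRLPN

end

/-!
Fix a set `𝒩` for which `e` has weight `u` on `𝒩`, and an auxiliary code `A`. As `y - e` lies in `C`,
the Fourier transform computed by the decoder takes at the right candidate `e_𝒫 Gᵀ` the value
`∑ (-1)^(⟨e_𝒩, h_𝒩⟩ + ⟨e_𝒫, h_𝒫 + c⟩)`, the sum being over the `h` in the dual of `C` and the `c` in
`A` with `|h_𝒩| = w` and `|h_𝒫 + c| = t_aux` (`fourier_lpnFun_eq`). This is a bilinear statistic of two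
independent uniformly random codes, the dual of `C` and `A`, whose first two moments are explicit:
the linear group is transitive on pairs of distinct nonzero binary vectors, so the memberships of
nonzero vectors in a random code are pairwise uncorrelated up to negative terms
(`expect_sum_mem_code_sq`). The zero vectors, which lie in every code, are split off.

The mean is close to `δ H̃`, as Krawtchouk polynomials are the Fourier transforms of spheres. The
variance is at most `H̃ (b₁ + b₂ + 1)`, where `b₁` and `b₂` are the two quantities assumed to be
`O(n^α)`: they count the samples that share an `h` or a `c`. Chebyshev's inequality bounds the
probability that the right candidate fails the threshold `δ H̃ / 2` by a multiple of
`errTerm = (b₁ + b₂ + 1) / (δ² H̃)`, which tends to `0` (`prob_pairSum_lt_le`).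

Orthogonality of the Krawtchouk polynomials gives `binom(n-s, u) K_w(u)² ≤ 2^(n-s) binom(n-s, w)`, hence
`binom(n-s, u) / 2^(n-k) ≤ errTerm` (`choose_le_errTerm_mul`). So with high probability `e` is the only
solution with its restriction to `𝒫` and weight `u` on `𝒩`, and the solver called on `e_𝒫` returns `e`
itself. The additional hypotheses of the second and third assertions exclude, by the same union
bound, any other solution with the weights of `e` on `𝒩` and `𝒫`, or with the weight of `e`.

The iterations share the code `C`. By Markov's inequality most codes have a success probability per
iteration of at least half the probability that `𝒩` splits `e` as expected, which is the inverse of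
`expIter`; for these codes the independent iterations all fail with probability at most
`exp(-N_iter / (2 expIter))` (`one_sub_le_prob_exists_iteration`).
-/

namespace DoubleRLPN

open scoped BigOperators

/-! ### Uniform probability on finite types -/

open Classical in
/-- The indicator of a proposition, as a real number. -/
noncomputable def ind (P : Prop) : ℝ := if P then 1 else 0

theorem ind_of {P : Prop} (h : P) : ind P = 1 := by simp [ind, h]

theorem ind_of_not {P : Prop} (h : ¬P) : ind P = 0 := by simp [ind, h]

theorem ind_nonneg (P : Prop) : 0 ≤ ind P := by
  unfold ind; split_ifs <;> norm_num

theorem ind_le_one (P : Prop) : ind P ≤ 1 := by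
  unfold ind; split_ifs <;> norm_num

theorem ind_mono {P Q : Prop} (h : P → Q) : ind P ≤ ind Q := by
  by_cases hP : P
  · rw [ind_of hP, ind_of (h hP)]
  · rw [ind_of_not hP]; exact ind_nonneg Q

theorem ind_congr {P Q : Prop} (h : P ↔ Q) : ind P = ind Q := by rw [propext h]

theorem ind_not (P : Prop) : ind (¬P) = 1 - ind P := by
  by_cases h : P <;> simp [ind, h]

theorem ind_and (P Q : Prop) : ind (P ∧ Q) = ind P * ind Q := by
  by_cases h : P <;> by_cases h' : Q <;> simp [ind, h, h']

theorem ind_mul_self (P : Prop) : ind P * ind P = ind P := by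
  by_cases h : P <;> simp [ind, h]

theorem sum_ind_eq_card {ι : Type*} [Fintype ι] (P : ι → Prop) [DecidablePred P] :
    ∑ i, ind (P i) = ((Finset.univ.filter P).card : ℝ) := by
  have h : ∀ i, ind (P i) = if P i then 1 else 0 := fun i => by unfold ind; congr
  rw [Finset.sum_congr rfl fun i _ => h i, Finset.sum_boole]

theorem prob_eq_expect {Ω : Type} [Fintype Ω] (E : Ω → Prop) :
    prob Ω E = 𝔼 ω, ind (E ω) := by
  classical
  rw [prob, Fintype.expect_eq_sum_div_card, sum_ind_eq_card, Nat.card_eq_fintype_card,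
    Nat.card_eq_fintype_card, Fintype.card_subtype]

section Prob

variable {Ω Ω' : Type}

theorem prob_congr {E F : Ω → Prop} (h : ∀ ω, E ω ↔ F ω) : prob Ω E = prob Ω F := by
  rw [funext fun ω => propext (h ω)]

theorem prob_nonneg (E : Ω → Prop) : 0 ≤ prob Ω E := by
  unfold prob; positivity

theorem prob_comp_equiv (g : Ω ≃ Ω') (E : Ω' → Prop) : prob Ω (fun ω => E (g ω)) = prob Ω' E := by
  unfold prob
  rw [Nat.card_congr g, Nat.card_congr (g.subtypeEquiv (p := fun ω => E (g ω)) (q := E)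
    fun ω => Iff.rfl)]

variable [Fintype Ω] [Fintype Ω']

theorem prob_mono {E F : Ω → Prop} (h : ∀ ω, E ω → F ω) : prob Ω E ≤ prob Ω F := by
  rw [prob_eq_expect, prob_eq_expect]
  exact Finset.expect_le_expect fun ω _ => ind_mono (h ω)

theorem prob_le_one (E : Ω → Prop) : prob Ω E ≤ 1 := by
  unfold prob
  refine div_le_one_of_le₀ ?_ (by positivity)
  exact_mod_cast Nat.card_le_card_of_injective _ Subtype.val_injective

theorem prob_not [Nonempty Ω] (E : Ω → Prop) : prob Ω (fun ω => ¬E ω) = 1 - prob Ω E := by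
  simp only [prob_eq_expect, ind_not, Finset.expect_sub_distrib, Fintype.expect_const]

theorem prob_or_le (E F : Ω → Prop) :
    prob Ω (fun ω => E ω ∨ F ω) ≤ prob Ω E + prob Ω F := by
  simp only [prob_eq_expect, ← Finset.expect_add_distrib]
  refine Finset.expect_le_expect fun ω _ => ?_
  by_cases hE : E ω <;> by_cases hF : F ω <;> simp [ind, hE, hF]

theorem prob_exists_le {ι : Type*} (s : Finset ι) (E : ι → Ω → Prop) :
    prob Ω (fun ω => ∃ i ∈ s, E i ω) ≤ ∑ i ∈ s, prob Ω (E i) := by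
  classical
  induction s using Finset.induction_on with
  | empty => simp [prob]
  | insert a s ha ih =>
    rw [Finset.sum_insert ha]
    refine (prob_mono fun ω h => ?_).trans ((prob_or_le _ _).trans (add_le_add_right ih _))
    simpa only [Finset.exists_mem_insert] using h

/-- **Markov's inequality.** -/
theorem prob_le_expect_div {f : Ω → ℝ} (hf : ∀ ω, 0 ≤ f ω) {a : ℝ} (ha : 0 < a) :
    prob Ω (fun ω => a ≤ f ω) ≤ (𝔼 ω, f ω) / a := by
  rw [prob_eq_expect, Finset.expect_div]
  refine Finset.expect_le_expect fun ω _ => ?_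
  by_cases h : a ≤ f ω
  · rw [ind_of h, one_le_div ha]; exact h
  · rw [ind_of_not h]; exact div_nonneg (hf ω) ha.le

/-- **Chebyshev's inequality.** -/
theorem prob_le_sub_le [Nonempty Ω] (f : Ω → ℝ) {τ : ℝ} (hτ : 0 < τ) :
    prob Ω (fun ω => f ω ≤ (𝔼 ω, f ω) - τ) ≤ ((𝔼 ω, f ω ^ 2) - (𝔼 ω, f ω) ^ 2) / τ ^ 2 := by
  set μ := 𝔼 ω, f ω with hμ
  have hvar : 𝔼 ω, (f ω - μ) ^ 2 = (𝔼 ω, f ω ^ 2) - μ ^ 2 := by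
    have : ∀ ω, (f ω - μ) ^ 2 = f ω ^ 2 - 2 * μ * f ω + μ ^ 2 := fun ω => by ring
    simp only [this, Finset.expect_add_distrib, Finset.expect_sub_distrib, ← Finset.mul_expect,
      Fintype.expect_const, ← hμ]
    ring
  rw [← hvar]
  refine (prob_mono fun ω h => ?_).trans
    (prob_le_expect_div (f := fun ω => (f ω - μ) ^ 2) (fun ω => sq_nonneg _) (pow_pos hτ 2))
  nlinarith

theorem expect_prod (f : Ω × Ω' → ℝ) : 𝔼 x, f x = 𝔼 ω, 𝔼 ω', f (ω, ω') :=
  Finset.expect_product Finset.univ Finset.univ f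

theorem prob_prod (E : Ω × Ω' → Prop) :
    prob (Ω × Ω') E = 𝔼 ω, prob Ω' (fun ω' => E (ω, ω')) := by
  simp only [prob_eq_expect, expect_prod]

theorem prob_fst [Nonempty Ω'] (E : Ω → Prop) :
    prob (Ω × Ω') (fun x => E x.1) = prob Ω E := by
  rw [prob_prod, prob_eq_expect]
  refine Finset.expect_congr rfl fun ω _ => ?_
  rw [prob_eq_expect]
  exact Fintype.expect_const (ι := Ω') (ind (E ω))

theorem prob_pi_eval {ι : Type} [Fintype ι] [DecidableEq ι] [Nonempty Ω] (j : ι)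
    (E : Ω → Prop) : prob (ι → Ω) (fun f => E (f j)) = prob Ω E := by
  rw [← prob_fst (Ω' := {i // i ≠ j} → Ω) E, ← prob_comp_equiv (Equiv.funSplitAt j Ω)]
  rfl

theorem prob_pi_forall {ι : Type} [Fintype ι] (E : Ω → Prop) :
    prob (ι → Ω) (fun f => ∀ i, E (f i)) = prob Ω E ^ Fintype.card ι := by
  classical
  unfold prob
  rw [div_pow, Nat.card_congr (Equiv.subtypePiEquivPi (p := fun _ : ι => E)), Nat.card_pi,
    Nat.card_pi]
  simp

end Prob

/-! ### Uniformly random codes -/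

noncomputable instance instFintypeCode (n k : ℕ) : Fintype (Code n k) := Fintype.ofFinite _

theorem nonempty_code {n k : ℕ} (h : k ≤ n) : Nonempty (Code n k) := by
  let b := Pi.basisFun (ZMod 2) (Fin n)
  have hli : LinearIndependent (ZMod 2) (fun i : Fin k => b (Fin.castLE h i)) :=
    b.linearIndependent.comp _ (Fin.castLE_injective h)
  exact ⟨⟨Submodule.span _ (Set.range fun i : Fin k => b (Fin.castLE h i)), by
    rw [finrank_span_eq_card hli, Fintype.card_fin]⟩⟩

/-- The action of a linear automorphism on codes. -/
def codeMap {n k : ℕ} (g : Vec n ≃ₗ[ZMod 2] Vec n) : Code n k ≃ Code n k where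
  toFun C := ⟨C.1.map (g : Vec n →ₗ[ZMod 2] Vec n), by rw [LinearEquiv.finrank_map_eq, C.2]⟩
  invFun C := ⟨C.1.map (g.symm : Vec n →ₗ[ZMod 2] Vec n), by
    rw [LinearEquiv.finrank_map_eq, C.2]⟩
  left_inv C := by ext x; simp
  right_inv C := by ext x; simp

theorem apply_mem_codeMap {n k : ℕ} (g : Vec n ≃ₗ[ZMod 2] Vec n) (C : Code n k) (x : Vec n) :
    g x ∈ (codeMap g C).1 ↔ x ∈ C.1 := by
  simp [codeMap]

/-- The general linear group acts transitively on linearly independent families. -/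
theorem exists_linearEquiv_apply_eq {ι K V : Type*} [Finite ι] [Field K] [AddCommGroup V]
    [Module K V] {v v' : ι → V} (hv : LinearIndependent K v) (hv' : LinearIndependent K v') :
    ∃ g : V ≃ₗ[K] V, ∀ i, g (v i) = v' i := by
  have : FiniteDimensional K (Submodule.span K (Set.range v)) :=
    FiniteDimensional.span_of_finite K (Set.finite_range v)
  obtain ⟨g, hg⟩ := Submodule.exists_linearEquiv_restrict_eq
    ((Module.Basis.span hv).equiv (Module.Basis.span hv') (Equiv.refl ι))
  refine ⟨g, fun i => ?_⟩
  have h := hg (Module.Basis.span hv i)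
  rw [Module.Basis.equiv_apply, Module.Basis.span_apply, Module.Basis.span_apply] at h
  exact h.symm

theorem linearIndependent_pair_zmod_two {V : Type*} [AddCommGroup V] [Module (ZMod 2) V]
    {x y : V} (hx : x ≠ 0) (hy : y ≠ 0) (hxy : x ≠ y) :
    LinearIndependent (ZMod 2) ![x, y] := by
  rw [LinearIndependent.pair_iff]
  have h2 : ∀ a : ZMod 2, a = 0 ∨ a = 1 := by decide
  intro a b hab
  rcases h2 a with rfl | rfl <;> rcases h2 b with rfl | rfl
  · simp
  · simp at hab; exact absurd hab hy
  · simp at hab; exact absurd hab hx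
  · refine absurd ?_ hxy
    have h : y + y = 0 := by
      have : (1 + 1 : ZMod 2) • y = 0 := by
        rw [show (1 + 1 : ZMod 2) = 0 from rfl, zero_smul]
      simpa [add_smul] using this
    simpa only [one_smul, ← eq_neg_iff_add_eq_zero, ← eq_neg_iff_add_eq_zero.mpr h] using hab

/-- The probability that a uniformly random `[n, d]`-code contains a given nonzero vector. -/
noncomputable def codeProb (n d : ℕ) : ℝ := (2 ^ d - 1) / (2 ^ n - 1)

theorem sum_ind_mem_code {n d : ℕ} (C : Code n d) : ∑ x, ind (x ∈ C.1) = (2 : ℝ) ^ d := by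
  classical
  rw [sum_ind_eq_card, ← Fintype.card_subtype]
  have h := Module.card_eq_pow_finrank (K := ZMod 2) (V := C.1)
  rw [C.2, ZMod.card] at h
  rw [Fintype.card_congr (Equiv.refl {x // x ∈ C.1}), h]
  norm_num

theorem sum_ind_ne_zero {n : ℕ} : ∑ x : Vec n, ind (x ≠ 0) = (2 : ℝ) ^ n - 1 := by
  have h : ∑ x : Vec n, ind (x = 0) = 1 := by
    rw [Finset.sum_eq_single 0 (fun x _ hx => ind_of_not hx) (by simp), ind_of rfl]
  simp only [Ne, ind_not, Finset.sum_sub_distrib, h]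
  simp

theorem sum_ind_mem_ne_zero {n d : ℕ} (C : Code n d) :
    ∑ x, ind (x ∈ C.1) * ind (x ≠ 0) = (2 : ℝ) ^ d - 1 := by
  have h : ∑ x : Vec n, ind (x ∈ C.1) * ind (x = 0) = 1 := by
    simp [ind]
  simp only [Ne, ind_not, mul_sub, Finset.sum_sub_distrib, h, mul_one, sum_ind_mem_code]

theorem expect_ind_mem_eq {n d : ℕ} (hd : d ≤ n) {x : Vec n} (hx : x ≠ 0) :
    𝔼 C : Code n d, ind (x ∈ C.1) = codeProb n d := by
  have := nonempty_code hd
  have hc : ∀ y : Vec n, (𝔼 C : Code n d, ind (y ∈ C.1)) * ind (y ≠ 0) =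
      (𝔼 C : Code n d, ind (x ∈ C.1)) * ind (y ≠ 0) := fun y => by
    by_cases hy : y = 0
    · rw [ind_of_not (not_not.mpr hy), mul_zero, mul_zero]
    obtain ⟨g, hg⟩ := exists_linearEquiv_apply_eq
      ((linearIndependent_unique_iff (R := ZMod 2) (v := fun _ : Fin 1 => x)).mpr hx)
      ((linearIndependent_unique_iff (R := ZMod 2) (v := fun _ : Fin 1 => y)).mpr hy)
    congr 1
    symm
    refine Fintype.expect_equiv (codeMap g) _ _ fun C => ?_
    rw [← hg 0, ind_congr (apply_mem_codeMap g C x)]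
  have h : ∑ y : Vec n, (𝔼 C : Code n d, ind (y ∈ C.1)) * ind (y ≠ 0) = (2 : ℝ) ^ d - 1 := by
    simp only [Finset.expect_mul]
    rw [← Finset.expect_sum_comm]
    simp only [sum_ind_mem_ne_zero, Fintype.expect_const]
  simp only [hc, ← Finset.mul_sum, sum_ind_ne_zero] at h
  have hn : (2 : ℝ) ^ n - 1 ≠ 0 := by
    rw [← sum_ind_ne_zero]
    refine (Finset.sum_pos' (fun y _ => ind_nonneg _) ⟨x, Finset.mem_univ _, ?_⟩).ne'
    rw [ind_of hx]; exact one_pos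
  rw [codeProb, ← h, mul_div_cancel_right₀ _ hn]

theorem codeProb_nonneg (n d : ℕ) : 0 ≤ codeProb n d :=
  div_nonneg (sub_nonneg.mpr (one_le_pow₀ one_le_two)) (sub_nonneg.mpr (one_le_pow₀ one_le_two))

theorem codeProb_le {n d : ℕ} (hd : d ≤ n) : codeProb n d ≤ 2 ^ d / 2 ^ n := by
  have h1 : (1 : ℝ) ≤ 2 ^ d := one_le_pow₀ one_le_two
  have h2 : (2 : ℝ) ^ d ≤ 2 ^ n := pow_le_pow_right₀ one_le_two hd
  rcases (h1.trans h2).eq_or_lt with h | h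
  · rw [codeProb, ← h, sub_self, div_zero]; positivity
  · rw [codeProb, div_le_div_iff₀ (by linarith) (by linarith)]
    nlinarith

theorem le_codeProb {n d : ℕ} (hd : d ≤ n) : (2 ^ d - 1) / 2 ^ n ≤ codeProb n d := by
  have h1 : (1 : ℝ) ≤ 2 ^ d := one_le_pow₀ one_le_two
  have h2 : (2 : ℝ) ^ d ≤ 2 ^ n := pow_le_pow_right₀ one_le_two hd
  rcases (h1.trans h2).eq_or_lt with h | h
  · rw [codeProb, ← h, sub_self, div_zero, le_antisymm (h2.trans h.ge) h1]; simp
  · rw [codeProb, div_le_div_iff₀ (by linarith) (by linarith)]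
    nlinarith

/-- A union bound: a random code rarely contains a nonzero vector of a given set. -/
theorem prob_exists_mem_code_le {n d : ℕ} (hd : d ≤ n) (s : Finset (Vec n)) (hs : 0 ∉ s) :
    prob (Code n d) (fun C => ∃ x ∈ s, x ∈ C.1) ≤ s.card * (2 ^ d / 2 ^ n) := by
  refine (prob_exists_le s _).trans ?_
  rw [← nsmul_eq_mul]
  refine Finset.sum_le_card_nsmul _ _ _ fun x hx => ?_
  rw [prob_eq_expect, expect_ind_mem_eq hd (fun h => hs (h ▸ hx))]
  exact codeProb_le hd

theorem expect_sum_mem_code {n d : ℕ} (hd : d ≤ n) {F : Vec n → ℝ} (hF : F 0 = 0) :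
    𝔼 C : Code n d, ∑ x, ind (x ∈ C.1) * F x = codeProb n d * ∑ x, F x := by
  rw [Finset.expect_sum_comm, Finset.mul_sum]
  refine Finset.sum_congr rfl fun x _ => ?_
  rw [← Finset.expect_mul]
  by_cases hx : x = 0
  · rw [hx, hF, mul_zero, mul_zero]
  · rw [expect_ind_mem_eq hd hx]

/-- The second moment of a linear statistic of a random code. Distinct nonzero vectors of `𝔽₂ⁿ` are
linearly independent, so that all such pairs have the same probability `P` to lie in the code;
these events are negatively correlated. -/
theorem expect_sum_mem_code_sq {n d : ℕ} (hd : d ≤ n) :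
    ∃ P : ℝ, 0 ≤ P ∧ P ≤ codeProb n d ^ 2 ∧ ∀ F : Vec n → ℝ, F 0 = 0 →
      𝔼 C : Code n d, (∑ x, ind (x ∈ C.1) * F x) ^ 2 =
        P * (∑ x, F x) ^ 2 + (codeProb n d - P) * ∑ x, F x ^ 2 := by
  classical
  have := nonempty_code hd
  set a := codeProb n d with ha
  let p : Vec n → Vec n → ℝ := fun x y => 𝔼 C : Code n d, ind (x ∈ C.1) * ind (y ∈ C.1)
  by_cases hex : ∃ x y : Vec n, x ≠ 0 ∧ y ≠ 0 ∧ x ≠ y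
  · obtain ⟨x₀, y₀, hx₀, hy₀, hxy₀⟩ := hex
    have hp : ∀ x y, x ≠ 0 → y ≠ 0 → x ≠ y → p x y = p x₀ y₀ := fun x y hx hy hxy => by
      obtain ⟨g, hg⟩ := exists_linearEquiv_apply_eq
        (linearIndependent_pair_zmod_two hx hy hxy)
        (linearIndependent_pair_zmod_two hx₀ hy₀ hxy₀)
      refine Fintype.expect_equiv (codeMap g) _ _ fun C => ?_
      have h0 : g x = x₀ := hg 0
      have h1 : g y = y₀ := hg 1
      rw [← h0, ← h1, ind_congr (apply_mem_codeMap g C x), ind_congr (apply_mem_codeMap g C y)]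
    have hpp : ∀ x, x ≠ 0 → p x x = a := fun x hx => by
      simp only [p, ind_mul_self]
      exact expect_ind_mem_eq hd hx
    have hmain : ∀ F : Vec n → ℝ, F 0 = 0 →
        𝔼 C : Code n d, (∑ x, ind (x ∈ C.1) * F x) ^ 2 =
          p x₀ y₀ * (∑ x, F x) ^ 2 + (a - p x₀ y₀) * ∑ x, F x ^ 2 := fun F hF => by
      have h1 : 𝔼 C : Code n d, (∑ x, ind (x ∈ C.1) * F x) ^ 2 =
          ∑ x, ∑ y, p x y * (F x * F y) := by
        simp only [sq, Finset.sum_mul_sum, p, Finset.expect_mul]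
        rw [Finset.expect_sum_comm]
        refine Finset.sum_congr rfl fun x _ => ?_
        rw [Finset.expect_sum_comm]
        refine Finset.sum_congr rfl fun y _ => Finset.expect_congr rfl fun C _ => by ring
      have h2 : ∀ x y, p x y * (F x * F y) =
          p x₀ y₀ * (F x * F y) + if x = y then (a - p x₀ y₀) * F x ^ 2 else 0 := fun x y => by
        by_cases hx : x = 0
        · simp [hx, hF]
        by_cases hy : y = 0
        · rw [hy, if_neg hx, hF]; ring
        by_cases hxy : x = y
        · rw [if_pos hxy, ← hxy, hpp x hx]; ring
        · rw [if_neg hxy, hp x y hx hy hxy, add_zero]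
      rw [h1]
      simp only [h2, Finset.sum_add_distrib, Finset.sum_ite_eq, Finset.mem_univ, if_true,
        ← Finset.mul_sum]
      rw [sq (∑ x, F x), Finset.sum_mul_sum]
      simp only [Finset.mul_sum]
    have hP0 : 0 ≤ p x₀ y₀ :=
      Finset.expect_nonneg fun C _ => mul_nonneg (ind_nonneg _) (ind_nonneg _)
    have hPa : p x₀ y₀ ≤ a := by
      rw [← hpp x₀ hx₀]
      refine Finset.expect_le_expect fun C _ => ?_
      rw [ind_mul_self]
      exact mul_le_of_le_one_right (ind_nonneg _) (ind_le_one _)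
    refine ⟨p x₀ y₀, hP0, ?_, hmain⟩
    -- The number of nonzero codewords is constant; its second moment is the square of its mean.
    have hN : (0 : ℝ) < 2 ^ n - 1 := by
      rw [← sum_ind_ne_zero]
      refine Finset.sum_pos' (fun y _ => ind_nonneg _) ⟨x₀, Finset.mem_univ _, ?_⟩
      rw [ind_of hx₀]; exact one_pos
    have h := hmain (fun x => ind (x ≠ 0)) (ind_of_not (by simp))
    simp only [sum_ind_mem_ne_zero, Fintype.expect_const, sq (ind _), ind_mul_self,
      sum_ind_ne_zero] at h
    have haN : a * (2 ^ n - 1) = 2 ^ d - 1 := div_mul_cancel₀ _ hN.ne'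
    rw [← haN] at h
    have h3 : 0 ≤ (a - p x₀ y₀) * (2 ^ n - 1) := mul_nonneg (sub_nonneg.mpr hPa) hN.le
    by_contra! h4
    have h5 := mul_lt_mul_of_pos_right h4 (pow_pos hN 2)
    nlinarith
  · refine ⟨0, le_rfl, sq_nonneg _, fun F hF => ?_⟩
    push Not at hex
    have h1 : ∀ C : Code n d, (∑ x, ind (x ∈ C.1) * F x) ^ 2 = ∑ x, ind (x ∈ C.1) * F x ^ 2 :=
      fun C => by
        rw [sq, Finset.sum_mul_sum]
        refine Finset.sum_congr rfl fun x _ => ?_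
        rw [Finset.sum_eq_single x]
        · linear_combination (F x) ^ 2 * ind_mul_self (x ∈ C.1)
        · intro y _ hyx
          by_cases hx : x = 0
          · rw [hx, hF]; ring
          by_cases hy : y = 0
          · rw [hy, hF]; ring
          exact absurd (hex x y hx hy).symm hyx
        · simp
    simp only [h1]
    rw [expect_sum_mem_code hd (by rw [hF]; ring)]
    ring

/-! ### Duality -/

/-- The dual code. -/
def dualCode {n k : ℕ} (C : Code n k) : Submodule (ZMod 2) (Vec n) :=
  LinearMap.BilinForm.orthogonal (dotProductBilin (ZMod 2) (ZMod 2)) C.1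

theorem mem_dualCode {n k : ℕ} {C : Code n k} {h : Vec n} :
    h ∈ dualCode C ↔ ∀ c ∈ C.1, c ⬝ᵥ h = 0 := Iff.rfl

theorem dotProductBilin_isRefl (n : ℕ) :
    LinearMap.BilinForm.IsRefl (dotProductBilin (m := Fin n) (ZMod 2) (ZMod 2)) :=
  fun x y h => by
    rw [dotProductBilin_apply_apply] at h ⊢
    rw [dotProduct_comm, h]

theorem dotProductBilin_nondegenerate (n : ℕ) :
    LinearMap.BilinForm.Nondegenerate (dotProductBilin (m := Fin n) (ZMod 2) (ZMod 2)) := by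
  refine (LinearMap.IsRefl.nondegenerate_iff_separatingLeft
    (dotProductBilin_isRefl n)).mpr fun x hx => ?_
  exact dotProduct_eq_zero_iff.mp fun y => hx y

/-- Duality is a bijection between codes of complementary dimensions. -/
def dualEquiv {n k l : ℕ} (h : k + l = n) : Code n k ≃ Code n l where
  toFun C := ⟨dualCode C, by
    rw [dualCode, LinearMap.BilinForm.finrank_orthogonal (dotProductBilin_nondegenerate n), C.2,
      Module.finrank_fin_fun]
    omega⟩
  invFun C := ⟨dualCode C, by
    rw [dualCode, LinearMap.BilinForm.finrank_orthogonal (dotProductBilin_nondegenerate n), C.2,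
      Module.finrank_fin_fun]
    omega⟩
  left_inv C := Subtype.ext (LinearMap.BilinForm.orthogonal_orthogonal
    (dotProductBilin_nondegenerate n) (dotProductBilin_isRefl n) C.1)
  right_inv C := Subtype.ext (LinearMap.BilinForm.orthogonal_orthogonal
    (dotProductBilin_nondegenerate n) (dotProductBilin_isRefl n) C.1)

/-! ### Characters and Krawtchouk polynomials -/

theorem sgn_zero : sgn 0 = 1 := by simp [sgn]

theorem sgn_one : sgn 1 = -1 := by simp [sgn, ZMod.val_one]

theorem zmod_two_cases (a : ZMod 2) : a = 0 ∨ a = 1 := by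
  revert a; decide

theorem sgn_add (a b : ZMod 2) : sgn (a + b) = sgn a * sgn b := by
  rcases zmod_two_cases a with rfl | rfl <;> rcases zmod_two_cases b with rfl | rfl
  · simp [sgn_zero]
  · simp [sgn_zero]
  · simp [sgn_zero]
  · rw [show (1 + 1 : ZMod 2) = 0 from rfl, sgn_zero, sgn_one]; norm_num

theorem abs_sgn (a : ZMod 2) : |sgn a| = 1 := by
  rcases zmod_two_cases a with rfl | rfl <;> simp [sgn_zero, sgn_one]

theorem sgn_sum {ι : Type*} (s : Finset ι) (f : ι → ZMod 2) :
    sgn (∑ i ∈ s, f i) = ∏ i ∈ s, sgn (f i) := by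
  classical
  induction s using Finset.induction_on with
  | empty => simp [sgn_zero]
  | insert a s ha ih => rw [Finset.sum_insert ha, Finset.prod_insert ha, sgn_add, ih]

theorem sum_zmod_two {M : Type*} [AddCommMonoid M] (f : ZMod 2 → M) : ∑ b, f b = f 0 + f 1 :=
  Fin.sum_univ_two f

theorem vec_add_self {m : ℕ} (x : Vec m) : x + x = 0 := by
  ext i
  exact CharTwo.add_self_eq_zero (x i)

theorem vec_add_eq_zero {m : ℕ} {x y : Vec m} : x + y = 0 ↔ x = y := by
  constructor
  · intro h
    rw [← add_zero x, ← vec_add_self y, ← add_assoc, h, zero_add]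
  · rintro rfl; exact vec_add_self x

theorem sum_sgn_dotProduct {m : ℕ} (z : Vec m) :
    ∑ x : Vec m, sgn (x ⬝ᵥ z) = if z = 0 then (2 : ℝ) ^ m else 0 := by
  have h : ∑ x : Vec m, sgn (x ⬝ᵥ z) = ∏ i, (1 + sgn (z i)) := by
    have := Fintype.prod_sum (fun (i : Fin m) (b : ZMod 2) => sgn (b * z i))
    simp only [sum_zmod_two, zero_mul, one_mul, sgn_zero] at this
    rw [this]
    refine Finset.sum_congr rfl fun x _ => ?_
    rw [dotProduct, sgn_sum]
  rw [h]
  split_ifs with hz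
  · simp only [hz, Pi.zero_apply, sgn_zero, Finset.prod_const, Finset.card_univ, Fintype.card_fin]
    norm_num
  · obtain ⟨i, hi⟩ : ∃ i, z i ≠ 0 := by
      by_contra! hc
      exact hz (funext hc)
    refine Finset.prod_eq_zero (Finset.mem_univ i) ?_
    rw [(zmod_two_cases (z i)).resolve_left hi, sgn_one]; norm_num

/-- **Parseval's identity** on `𝔽₂^m`. -/
theorem sum_sum_mul_sgn_sq {m : ℕ} (F : Vec m → ℝ) :
    ∑ x : Vec m, (∑ h, F h * sgn (x ⬝ᵥ h)) ^ 2 = 2 ^ m * ∑ h, F h ^ 2 := by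
  have h1 : ∀ x : Vec m, (∑ h, F h * sgn (x ⬝ᵥ h)) ^ 2 =
      ∑ h, ∑ h', F h * F h' * sgn (x ⬝ᵥ (h + h')) := fun x => by
    rw [sq, Finset.sum_mul_sum]
    refine Finset.sum_congr rfl fun h _ => Finset.sum_congr rfl fun h' _ => ?_
    rw [dotProduct_add, sgn_add]; ring
  simp only [h1]
  rw [Finset.sum_comm, Finset.mul_sum]
  refine Finset.sum_congr rfl fun h _ => ?_
  rw [Finset.sum_comm]
  simp only [← Finset.mul_sum, sum_sgn_dotProduct, vec_add_eq_zero, mul_ite, mul_zero,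
    Finset.sum_ite_eq, Finset.mem_univ, if_true]
  ring

theorem coeff_one_sub_X_pow (n j : ℕ) :
    ((1 - Polynomial.X : Polynomial ℝ) ^ n).coeff j = (-1) ^ j * (n.choose j : ℝ) := by
  have h : (1 - Polynomial.X : Polynomial ℝ) ^ n =
      ((1 + Polynomial.X : Polynomial ℝ) ^ n).comp (Polynomial.C (-1) * Polynomial.X) := by
    simp [sub_eq_add_neg]
  rw [h, Polynomial.comp_C_mul_X_coeff, Polynomial.coeff_one_add_X_pow, mul_comm]

/-- The Krawtchouk polynomials are the Fourier transforms of the spheres: both sides are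
coefficients of the generating polynomial `(1 - X)^|x| (1 + X)^(m - |x|)`. -/
theorem sum_sphere_sgn {m : ℕ} (w : ℕ) (x : Vec m) :
    ∑ h : Vec m, ind (hammingNorm h = w) * sgn (x ⬝ᵥ h) = krawtchouk m w (hammingNorm x) := by
  classical
  open Polynomial in
  have h1 : ∑ h : Vec m, C (sgn (x ⬝ᵥ h)) * X ^ (hammingNorm h) =
      (1 - X : ℝ[X]) ^ hammingNorm x * (1 + X) ^ (m - hammingNorm x) := by
    have := Fintype.prod_sum
      (fun (i : Fin m) (b : ZMod 2) => C (sgn (x i * b)) * (X : ℝ[X]) ^ (if b ≠ 0 then 1 else 0))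
    have hR : ∀ h : Vec m, ∏ i, (C (sgn (x i * h i)) * (X : ℝ[X]) ^ (if h i ≠ 0 then 1 else 0)) =
        C (sgn (x ⬝ᵥ h)) * X ^ (hammingNorm h) := fun h => by
      rw [Finset.prod_mul_distrib, Finset.prod_pow_eq_pow_sum, dotProduct, sgn_sum, map_prod,
        hammingNorm, Finset.card_filter]
    rw [← Finset.sum_congr rfl fun h _ => hR h, ← this]
    have hL : ∀ i, ∑ b : ZMod 2, C (sgn (x i * b)) * (X : ℝ[X]) ^ (if b ≠ 0 then 1 else 0) =
        if x i ≠ 0 then 1 - X else 1 + X := fun i => by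
      rw [sum_zmod_two]
      rcases zmod_two_cases (x i) with h | h <;> simp [h, sgn_zero, sgn_one, sub_eq_add_neg]
    simp only [hL]
    rw [Finset.prod_ite, Finset.prod_const, Finset.prod_const, hammingNorm]
    congr 2
    have := Finset.card_filter_add_card_filter_not (s := (Finset.univ : Finset (Fin m)))
      (fun i => x i ≠ 0)
    rw [Finset.card_univ, Fintype.card_fin] at this
    omega
  have h2 := congrArg (fun p => Polynomial.coeff p w) h1
  simp only [Polynomial.finsetSum_coeff, Polynomial.coeff_C_mul, Polynomial.coeff_X_pow] at h2
  simp only [Polynomial.coeff_mul, coeff_one_sub_X_pow, Polynomial.coeff_one_add_X_pow] at h2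
  rw [Finset.Nat.sum_antidiagonal_eq_sum_range_succ_mk] at h2
  rw [krawtchouk, ← h2]
  refine Finset.sum_congr rfl fun h _ => ?_
  rw [mul_comm]
  congr 1
  simp only [ind, eq_comm]

theorem krawtchouk_zero (m w : ℕ) : krawtchouk m w 0 = m.choose w := by
  rw [krawtchouk, Finset.sum_eq_single 0]
  · simp
  · intro j _ hj
    rw [Nat.choose_eq_zero_of_lt (Nat.pos_of_ne_zero hj)]; simp
  · simp

theorem sum_sphere (m w : ℕ) : ∑ h : Vec m, ind (hammingNorm h = w) = m.choose w := by
  rw [← krawtchouk_zero, ← hammingNorm_zero (β := fun _ : Fin m => ZMod 2), ← sum_sphere_sgn]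
  simp [sgn_zero]

theorem exists_hammingNorm_eq {m u : ℕ} (hu : u ≤ m) : ∃ x : Vec m, hammingNorm x = u := by
  by_contra! hc
  have h := sum_sphere m u
  rw [Finset.sum_eq_zero fun x _ => ind_of_not (hc x)] at h
  exact (Nat.choose_pos hu).ne (by exact_mod_cast h)

theorem abs_krawtchouk_le {m u : ℕ} (w : ℕ) (hu : u ≤ m) : |krawtchouk m w u| ≤ m.choose w := by
  obtain ⟨x, rfl⟩ := exists_hammingNorm_eq hu
  rw [← sum_sphere_sgn, ← sum_sphere]
  refine (Finset.abs_sum_le_sum_abs _ _).trans (Finset.sum_le_sum fun h _ => ?_)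
  rw [abs_mul, abs_sgn, mul_one, abs_of_nonneg (ind_nonneg _)]

/-- The bound that follows from the orthogonality of the Krawtchouk polynomials. -/
theorem choose_mul_krawtchouk_sq_le (m w u : ℕ) :
    m.choose u * krawtchouk m w u ^ 2 ≤ 2 ^ m * m.choose w := by
  have h := sum_sum_mul_sgn_sq (fun h : Vec m => ind (hammingNorm h = w))
  simp only [sum_sphere_sgn, sq (ind _), ind_mul_self, sum_sphere] at h
  rw [← h, ← sum_sphere, Finset.sum_mul]
  refine Finset.sum_le_sum fun x _ => ?_
  by_cases hx : hammingNorm x = u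
  · rw [ind_of hx, one_mul, hx]
  · rw [ind_of_not hx, zero_mul]; exact sq_nonneg _

/-! ### Moments of bilinear statistics of two independent codes -/

/-- A bilinear statistic, with kernel `T`, of two codes. -/
noncomputable def pairSum {n s d₁ d₂ : ℕ} (T : Vec n → Vec s → ℝ) (x : Code n d₁ × Code s d₂) : ℝ :=
  ∑ h, ∑ c, ind (h ∈ x.1.1) * ind (c ∈ x.2.1) * T h c

theorem pairSum_eq_right {n s d₁ d₂ : ℕ} (T : Vec n → Vec s → ℝ) (D : Code n d₁) (A : Code s d₂) :
    pairSum T (D, A) = ∑ c, ind (c ∈ A.1) * ∑ h, ind (h ∈ D.1) * T h c := by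
  rw [pairSum, Finset.sum_comm]
  simp only [Finset.mul_sum]
  refine Finset.sum_congr rfl fun c _ => Finset.sum_congr rfl fun h _ => by ring

section Moments

variable {n s d₁ d₂ : ℕ} (hd₁ : d₁ ≤ n) (hd₂ : d₂ ≤ s) {T : Vec n → Vec s → ℝ}

include hd₁ hd₂

theorem expect_pairSum (hT : ∀ c, T 0 c = 0) (hT' : ∀ h, T h 0 = 0) :
    𝔼 x : Code n d₁ × Code s d₂, pairSum T x =
      codeProb n d₁ * codeProb s d₂ * ∑ h, ∑ c, T h c := by
  have h1 : ∀ D : Code n d₁, 𝔼 A : Code s d₂, pairSum T (D, A) =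
      codeProb s d₂ * ∑ h, ind (h ∈ D.1) * ∑ c, T h c := fun D => by
    simp only [pairSum_eq_right]
    rw [expect_sum_mem_code hd₂ (by simp [hT']), Finset.sum_comm]
    simp only [Finset.mul_sum]
  simp only [expect_prod, h1, ← Finset.mul_expect]
  rw [expect_sum_mem_code hd₁ (by simp [hT])]
  ring

/-- The variance of a bilinear statistic is controlled by the row sums, the column sums and the
entries of its kernel. -/
theorem expect_pairSum_sq_le (hT : ∀ c, T 0 c = 0) (hT' : ∀ h, T h 0 = 0) :
    𝔼 x : Code n d₁ × Code s d₂, pairSum T x ^ 2 ≤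
      (codeProb n d₁ * codeProb s d₂ * ∑ h, ∑ c, T h c) ^ 2 +
      codeProb n d₁ * codeProb s d₂ ^ 2 * ∑ h, (∑ c, T h c) ^ 2 +
      codeProb n d₁ ^ 2 * codeProb s d₂ * ∑ c, (∑ h, T h c) ^ 2 +
      codeProb n d₁ * codeProb s d₂ * ∑ h, ∑ c, T h c ^ 2 := by
  obtain ⟨P₁, hP₁, hP₁', hsq₁⟩ := expect_sum_mem_code_sq hd₁
  obtain ⟨P₂, hP₂, hP₂', hsq₂⟩ := expect_sum_mem_code_sq hd₂
  set a₁ := codeProb n d₁ with ha₁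
  set a₂ := codeProb s d₂ with ha₂
  have ha₁0 : 0 ≤ a₁ := codeProb_nonneg _ _
  have ha₂0 : 0 ≤ a₂ := codeProb_nonneg _ _
  have h1 : ∀ D : Code n d₁, 𝔼 A : Code s d₂, pairSum T (D, A) ^ 2 =
      P₂ * (∑ h, ind (h ∈ D.1) * ∑ c, T h c) ^ 2 +
        (a₂ - P₂) * ∑ c, (∑ h, ind (h ∈ D.1) * T h c) ^ 2 := fun D => by
    simp only [pairSum_eq_right]
    rw [hsq₂ _ (by simp [hT']), Finset.sum_comm]
    simp only [Finset.mul_sum]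
  have h2 : 𝔼 x : Code n d₁ × Code s d₂, pairSum T x ^ 2 =
      P₂ * (P₁ * (∑ h, ∑ c, T h c) ^ 2 + (a₁ - P₁) * ∑ h, (∑ c, T h c) ^ 2) +
      (a₂ - P₂) * (P₁ * ∑ c, (∑ h, T h c) ^ 2 + (a₁ - P₁) * ∑ h, ∑ c, T h c ^ 2) := by
    simp only [expect_prod, h1, Finset.expect_add_distrib, ← Finset.mul_expect]
    rw [hsq₁ _ (by simp [hT]), Finset.expect_sum_comm]
    rw [Finset.sum_congr rfl fun c _ => hsq₁ (fun h => T h c) (hT c)]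
    simp only [Finset.sum_add_distrib, ← Finset.mul_sum]
    rw [Finset.sum_comm (f := fun c h => T h c ^ 2)]
  have hS := sq_nonneg (∑ h, ∑ c, T h c)
  have hR : 0 ≤ ∑ h, (∑ c, T h c) ^ 2 := Finset.sum_nonneg fun _ _ => sq_nonneg _
  have hC : 0 ≤ ∑ c, (∑ h, T h c) ^ 2 := Finset.sum_nonneg fun _ _ => sq_nonneg _
  have hQ : 0 ≤ ∑ h, ∑ c, T h c ^ 2 :=
    Finset.sum_nonneg fun _ _ => Finset.sum_nonneg fun _ _ => sq_nonneg _
  rw [h2]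
  have e1 : P₁ * P₂ * (∑ h, ∑ c, T h c) ^ 2 ≤ a₁ ^ 2 * a₂ ^ 2 * (∑ h, ∑ c, T h c) ^ 2 := by
    gcongr
  have e2 : P₂ * (a₁ - P₁) * ∑ h, (∑ c, T h c) ^ 2 ≤ a₂ ^ 2 * a₁ * ∑ h, (∑ c, T h c) ^ 2 :=
    mul_le_mul_of_nonneg_right
      ((mul_le_mul_of_nonneg_left (sub_le_self _ hP₁) hP₂).trans
        (mul_le_mul_of_nonneg_right hP₂' ha₁0)) hR
  have e3 : P₁ * (a₂ - P₂) * ∑ c, (∑ h, T h c) ^ 2 ≤ a₁ ^ 2 * a₂ * ∑ c, (∑ h, T h c) ^ 2 :=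
    mul_le_mul_of_nonneg_right
      ((mul_le_mul_of_nonneg_left (sub_le_self _ hP₂) hP₁).trans
        (mul_le_mul_of_nonneg_right hP₁' ha₂0)) hC
  have e4 : (a₁ - P₁) * (a₂ - P₂) * ∑ h, ∑ c, T h c ^ 2 ≤ a₁ * a₂ * ∑ h, ∑ c, T h c ^ 2 := by
    refine mul_le_mul_of_nonneg_right ?_ hQ
    have q1 : P₁ ≤ a₁ := hP₁'.trans (by
      have : a₁ ≤ 1 := (codeProb_le hd₁).trans
        (div_le_one_of_le₀ (pow_le_pow_right₀ one_le_two hd₁) (by positivity))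
      nlinarith)
    exact (mul_le_mul_of_nonneg_left (sub_le_self _ hP₂) (sub_nonneg.mpr q1)).trans
      (mul_le_mul_of_nonneg_right (sub_le_self _ hP₁) ha₂0)
  nlinarith [e1, e2, e3, e4]

end Moments

/-! ### Splitting the positions -/

section Split

variable {n s : ℕ} (N : PosSet n s)

theorem card_posSet : N.1.card = n - s := by
  have h := N.2
  omega

/-- The restriction `x_𝒩` of `x` to the positions in `𝒩`, listed in increasing order. -/
def restrictN (x : Vec n) : Vec (n - s) := fun j => x (N.1.orderEmbOfFin (card_posSet N) j)

/-- The positions, split into `𝒩` and its complement. -/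
def posEquiv : Fin (n - s) ⊕ Fin s ≃ Fin n :=
  finSumEquivOfFinset (card_posSet N) (card_compl_posSet N)

/-- A vector amounts to its restrictions to `𝒩` and to its complement. -/
def splitEquiv : Vec n ≃ Vec (n - s) × Vec s :=
  ((posEquiv N).arrowCongr (Equiv.refl (ZMod 2))).symm.trans
    (Equiv.sumArrowEquivProdArrow _ _ _)

theorem splitEquiv_apply (x : Vec n) : splitEquiv N x = (restrictN N x, restrictP N x) := rfl

theorem sum_split {M : Type*} [AddCommMonoid M] (f : Fin n → M) :
    ∑ i, f i = ∑ j, f (N.1.orderEmbOfFin (card_posSet N) j) +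
      ∑ j, f ((N.1ᶜ).orderEmbOfFin (card_compl_posSet N) j) := by
  rw [← Equiv.sum_comp (posEquiv N) f, Fintype.sum_sum_type]
  rfl

theorem dotProduct_split (x y : Vec n) :
    x ⬝ᵥ y = restrictN N x ⬝ᵥ restrictN N y + restrictP N x ⬝ᵥ restrictP N y :=
  sum_split N fun i => x i * y i

theorem hammingNorm_split (x : Vec n) :
    hammingNorm x = hammingNorm (restrictN N x) + hammingNorm (restrictP N x) := by
  simp only [hammingNorm, Finset.card_filter]
  exact sum_split N fun i => if x i ≠ 0 then 1 else 0

theorem weightN_eq (x : Vec n) : weightN N x = hammingNorm (restrictN N x) := by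
  have h : N.1 = Finset.univ.map (N.1.orderEmbOfFin (card_posSet N)).toEmbedding := by simp
  unfold weightN hammingNorm restrictN
  rw [Finset.card_filter, Finset.card_filter]
  conv_lhs => rw [h]
  rw [Finset.sum_map]
  rfl

theorem sum_restrictN (φ : Vec (n - s) → ℝ) :
    ∑ h : Vec n, φ (restrictN N h) = 2 ^ s * ∑ x, φ x := by
  have := Equiv.sum_comp (splitEquiv N) (fun x => φ x.1)
  simp only [splitEquiv_apply] at this
  rw [this, Fintype.sum_prod_type]
  simp [Finset.mul_sum]

theorem sum_restrict_row (φ : Vec (n - s) → ℝ) (ψ : Vec s → ℝ) (h : Vec n) :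
    ∑ c, φ (restrictN N h) * ψ (restrictP N h + c) = φ (restrictN N h) * ∑ z, ψ z :=
  (Finset.mul_sum _ _ _).symm.trans
    (congrArg (φ (restrictN N h) * ·) (Equiv.sum_comp (Equiv.addLeft (restrictP N h)) ψ))

theorem sum_restrict_column (φ : Vec (n - s) → ℝ) (ψ : Vec s → ℝ) (c : Vec s) :
    ∑ h : Vec n, φ (restrictN N h) * ψ (restrictP N h + c) = (∑ x, φ x) * ∑ z, ψ z := by
  have := Equiv.sum_comp (splitEquiv N) (fun x => φ x.1 * ψ (x.2 + c))
  simp only [splitEquiv_apply] at this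
  rw [this, Fintype.sum_prod_type, Finset.sum_mul]
  refine Finset.sum_congr rfl fun x _ => ?_
  exact (Finset.mul_sum _ _ _).symm.trans
    (congrArg (φ x * ·) (Equiv.sum_comp (Equiv.addRight c) ψ))

end Split

/-! ### The score of the right candidate -/

/-- The sphere of radius `w`, with the signs `(-1)^⟨x, ·⟩`. -/
noncomputable def sphereSgn {m : ℕ} (x : Vec m) (w : ℕ) (h : Vec m) : ℝ :=
  ind (hammingNorm h = w) * sgn (x ⬝ᵥ h)

theorem abs_sphereSgn {m : ℕ} (x : Vec m) (w : ℕ) (h : Vec m) :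
    |sphereSgn x w h| = ind (hammingNorm h = w) := by
  rw [sphereSgn, abs_mul, abs_sgn, mul_one, abs_of_nonneg (ind_nonneg _)]

theorem sum_sphereSgn {m : ℕ} (x : Vec m) (w : ℕ) :
    ∑ h, sphereSgn x w h = krawtchouk m w (hammingNorm x) := sum_sphere_sgn w x

/-- The sign `(-1)^(⟨e_𝒩, h_𝒩⟩ + ⟨e_𝒫, h_𝒫 + c⟩)` of the LPN sample given by a parity-check `h` and
an auxiliary codeword `c`, or `0` if `h` and `c` do not have the required weights. -/
noncomputable def scoreKernel {n s : ℕ} (N : PosSet n s) (e : Vec n) (w τ : ℕ) (h : Vec n)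
    (c : Vec s) : ℝ :=
  sphereSgn (restrictN N e) w (restrictN N h) * sphereSgn (restrictP N e) τ (restrictP N h + c)

theorem scoreKernel_eq {n s : ℕ} (N : PosSet n s) (e : Vec n) (w τ : ℕ) (h : Vec n) (c : Vec s) :
    scoreKernel N e w τ h c =
      ind (weightN N h = w ∧ hammingNorm (restrictP N h + c) = τ) *
        (sgn (e ⬝ᵥ h) * sgn (restrictP N e ⬝ᵥ c)) := by
  rw [scoreKernel, sphereSgn, sphereSgn, ind_and, weightN_eq, dotProduct_split N, dotProduct_add,
    sgn_add, sgn_add]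
  ring

theorem sum_vecMul_genMatrix {m l : ℕ} (A : Code m l) (g : Vec m → ℝ) :
    ∑ v : Vec l, g (Matrix.vecMul v (genMatrix A)) = ∑ c, ind (c ∈ A.1) * g c := by
  classical
  set b := Module.finBasisOfFinrankEq (ZMod 2) A.1 A.2 with hb
  have h1 : ∀ v : Vec l, Matrix.vecMul v (genMatrix A) = ((b.equivFun.symm v : A.1) : Vec m) :=
    fun v => by
      rw [Module.Basis.equivFun_symm_apply, Submodule.coe_sum]
      ext i
      simp [Matrix.vecMul, dotProduct, genMatrix, hb]
  simp only [h1]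
  have h2 := Equiv.sum_comp b.equivFun.symm.toEquiv (fun a : A.1 => g a)
  have h3 : ∑ a : A.1, g a = ∑ c, ind (c ∈ A.1) * g c := by
    have : ∀ c, ind (c ∈ A.1) * g c = if c ∈ A.1 then g c else 0 := fun c => by
      by_cases hc : c ∈ A.1
      · rw [ind_of hc, if_pos hc, one_mul]
      · rw [ind_of_not hc, if_neg hc, zero_mul]
    rw [Finset.sum_congr rfl fun c _ => this c, ← Finset.sum_filter]
    exact (Finset.sum_subtype _ (by simp) _).symm
  rw [← h3, ← h2]
  rfl

theorem mem_lpnSamples {n : ℕ} {q : Params} {C : Code n q.k} {N : PosSet n q.s}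
    {A : Code q.s q.kAux} {h : Vec n} {c : Vec q.s} :
    (h, c) ∈ lpnSamples q C N A ↔ (h ∈ dualCode C ∧ c ∈ A.1) ∧
      weightN N h = q.w ∧ hammingNorm (restrictP N h + c) = q.tAux := by
  simp only [lpnSamples, parityCheckEquations, decode, Finset.mem_biUnion, Finset.mem_filter,
    Finset.mem_univ, true_and, Finset.mem_product, Finset.mem_singleton, mem_dualCode]
  constructor
  · rintro ⟨h', ⟨h1, h2⟩, rfl, h3, h4⟩
    exact ⟨⟨h1, h3⟩, h2, h4⟩
  · rintro ⟨⟨h1, h3⟩, h2, h4⟩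
    exact ⟨h, ⟨h1, h2⟩, rfl, h3, h4⟩

/-- The value at `e_𝒫 Gᵀ` of the Fourier transform computed by the decoder is a bilinear statistic
of the dual of the code and of the auxiliary code. -/
theorem fourier_lpnFun_eq {n : ℕ} (q : Params) (hk : q.k ≤ n) (C : Code n q.k) (N : PosSet n q.s)
    (A : Code q.s q.kAux) {c₀ : Vec n} (hc₀ : c₀ ∈ C.1) (e : Vec n) :
    fourier (lpnFun (c₀ + e) (lpnSamples q C N A) (genMatrix A))
        ((genMatrix A).mulVec (restrictP N e)) =
      pairSum (scoreKernel N e q.w q.tAux) (dualEquiv (Nat.add_sub_cancel' hk) C, A) := by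
  classical
  have h1 : ∀ v, lpnFun (c₀ + e) (lpnSamples q C N A) (genMatrix A) v *
      sgn ((genMatrix A).mulVec (restrictP N e) ⬝ᵥ v) =
      (fun c => (∑ h, ind ((h, c) ∈ lpnSamples q C N A) * sgn ((c₀ + e) ⬝ᵥ h)) *
        sgn (restrictP N e ⬝ᵥ c)) (Matrix.vecMul v (genMatrix A)) := fun v => by
    rw [dotProduct_comm, Matrix.dotProduct_mulVec, dotProduct_comm, lpnFun, Finset.sum_filter]
    simp only
    congr 2
    ext h
    by_cases hh : (h, Matrix.vecMul v (genMatrix A)) ∈ lpnSamples q C N A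
    · rw [if_pos hh, ind_of hh, one_mul]
    · rw [if_neg hh, ind_of_not hh, zero_mul]
  refine (Finset.sum_congr rfl fun v _ => h1 v).trans ((sum_vecMul_genMatrix A
    (fun c => (∑ h, ind ((h, c) ∈ lpnSamples q C N A) * sgn ((c₀ + e) ⬝ᵥ h)) *
      sgn (restrictP N e ⬝ᵥ c))).trans ?_)
  rw [pairSum, Finset.sum_comm]
  refine Finset.sum_congr rfl fun c _ => ?_
  rw [Finset.sum_mul, Finset.mul_sum]
  refine Finset.sum_congr rfl fun h _ => ?_
  rw [scoreKernel_eq, ind_congr mem_lpnSamples, ind_and, ind_and]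
  change _ = ind (h ∈ dualCode C) * _ * _
  by_cases hd : h ∈ dualCode C
  · rw [add_dotProduct, mem_dualCode.mp hd c₀ hc₀, zero_add]
    linear_combination ind (h ∈ dualCode C) *
      ind (weightN N h = q.w ∧ hammingNorm (restrictP N h + c) = q.tAux) * sgn (e ⬝ᵥ h) *
      sgn (restrictP N e ⬝ᵥ c) * ind_mul_self (c ∈ A.1)
  · rw [ind_of_not hd]; ring

/-! ### The right candidate passes the threshold -/

theorem sum_abs_scoreKernel_row {n s : ℕ} (N : PosSet n s) (e : Vec n) (w τ : ℕ) (h : Vec n) :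
    ∑ c, |scoreKernel N e w τ h c| = ind (hammingNorm (restrictN N h) = w) * s.choose τ := by
  simp only [scoreKernel, abs_mul, abs_sphereSgn]
  rw [sum_restrict_row N (fun x => ind (hammingNorm x = w)) (fun z => ind (hammingNorm z = τ)),
    sum_sphere]

theorem sum_abs_scoreKernel_column {n s : ℕ} (N : PosSet n s) (e : Vec n) (w τ : ℕ) (c : Vec s) :
    ∑ h, |scoreKernel N e w τ h c| = (n - s).choose w * s.choose τ := by
  simp only [scoreKernel, abs_mul, abs_sphereSgn]
  rw [sum_restrict_column N (fun x => ind (hammingNorm x = w)) (fun z => ind (hammingNorm z = τ)),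
    sum_sphere, sum_sphere]

theorem sum_scoreKernel {n s : ℕ} (N : PosSet n s) (e : Vec n) (w τ : ℕ) :
    ∑ h, ∑ c, scoreKernel N e w τ h c = 2 ^ s *
      (krawtchouk (n - s) w (weightN N e) * krawtchouk s τ (hammingNorm (restrictP N e))) := by
  simp only [scoreKernel]
  rw [Finset.sum_congr rfl fun h _ => sum_restrict_row N _ _ h, ← Finset.sum_mul,
    sum_restrictN N, sum_sphereSgn, sum_sphereSgn, weightN_eq, mul_assoc]

theorem abs_scoreKernel_le_one {n s : ℕ} (N : PosSet n s) (e : Vec n) (w τ : ℕ) (h : Vec n)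
    (c : Vec s) : |scoreKernel N e w τ h c| ≤ 1 := by
  rw [scoreKernel, abs_mul, abs_sphereSgn, abs_sphereSgn]
  exact mul_le_one₀ (ind_le_one _) (ind_nonneg _) (ind_le_one _)

/-- The part of a kernel away from the zero vectors, on which the memberships of a vector in a random
code are pairwise uncorrelated up to negative terms. -/
noncomputable def offZero {n s : ℕ} (T : Vec n → Vec s → ℝ) (h : Vec n) (c : Vec s) : ℝ :=
  ind (h ≠ 0 ∧ c ≠ 0) * T h c

theorem abs_offZero_le {n s : ℕ} (T : Vec n → Vec s → ℝ) (h : Vec n) (c : Vec s) :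
    |offZero T h c| ≤ |T h c| := by
  rw [offZero, abs_mul, abs_of_nonneg (ind_nonneg _)]
  exact mul_le_of_le_one_left (abs_nonneg _) (ind_le_one _)

theorem abs_sub_offZero_le {n s : ℕ} (T : Vec n → Vec s → ℝ) (h : Vec n) (c : Vec s) :
    |T h c - offZero T h c| ≤ ind (h = 0) * |T 0 c| + ind (c = 0) * |T h 0| := by
  rw [offZero]
  by_cases h0 : h = 0
  · rw [ind_of_not (fun hc => hc.1 h0), ind_of h0, h0]
    simpa using mul_nonneg (ind_nonneg _) (abs_nonneg _)
  · by_cases c0 : c = 0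
    · rw [ind_of_not (fun hc => hc.2 c0), ind_of_not h0, ind_of c0, c0]
      simp
    · rw [ind_of ⟨h0, c0⟩, ind_of_not h0, ind_of_not c0]
      simp

theorem sum_ind_eq_mul {m : ℕ} (a : Vec m) (F : Vec m → ℝ) : ∑ x, ind (x = a) * F x = F a := by
  rw [Finset.sum_eq_single a (fun x _ hx => by rw [ind_of_not hx, zero_mul]) (by simp),
    ind_of rfl, one_mul]

theorem abs_pairSum_sub_offZero_le {n s d₁ d₂ : ℕ} (T : Vec n → Vec s → ℝ) (D : Code n d₁)
    (A : Code s d₂) :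
    |pairSum T (D, A) - pairSum (offZero T) (D, A)| ≤
      ∑ c, ind (c ∈ A.1) * |T 0 c| + ∑ h, ind (h ∈ D.1) * |T h 0| := by
  have h1 : pairSum T (D, A) - pairSum (offZero T) (D, A) =
      ∑ h, ∑ c, ind (h ∈ D.1) * ind (c ∈ A.1) * (T h c - offZero T h c) := by
    simp only [pairSum, ← Finset.sum_sub_distrib, mul_sub]
  have h2 : ∑ h, ∑ c, (ind (h = 0) * (ind (c ∈ A.1) * |T 0 c|) +
      ind (c = 0) * (ind (h ∈ D.1) * |T h 0|)) =
      ∑ c, ind (c ∈ A.1) * |T 0 c| + ∑ h, ind (h ∈ D.1) * |T h 0| := by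
    simp only [Finset.sum_add_distrib, ← Finset.mul_sum]
    rw [sum_ind_eq_mul 0 (fun _ => ∑ c, ind (c ∈ A.1) * |T 0 c|)]
    congr 1
    refine Finset.sum_congr rfl fun h _ => ?_
    exact sum_ind_eq_mul 0 (fun _ => ind (h ∈ D.1) * |T h 0|)
  rw [h1, ← h2]
  refine (Finset.abs_sum_le_sum_abs _ _).trans (Finset.sum_le_sum fun h _ => ?_)
  refine (Finset.abs_sum_le_sum_abs _ _).trans (Finset.sum_le_sum fun c _ => ?_)
  have hD := ind_nonneg (h ∈ D.1)
  have hD1 := ind_le_one (h ∈ D.1)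
  have hA := ind_nonneg (c ∈ A.1)
  have hA1 := ind_le_one (c ∈ A.1)
  rw [abs_mul, abs_mul, abs_of_nonneg hD, abs_of_nonneg hA]
  refine (mul_le_mul_of_nonneg_left (abs_sub_offZero_le T h c) (mul_nonneg hD hA)).trans ?_
  have p1 : 0 ≤ ind (h = 0) * |T 0 c| := mul_nonneg (ind_nonneg _) (abs_nonneg _)
  have p2 : 0 ≤ ind (c = 0) * |T h 0| := mul_nonneg (ind_nonneg _) (abs_nonneg _)
  have q1 := mul_le_mul_of_nonneg_right (mul_le_of_le_one_left hA hD1) p1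
  have q2 := mul_le_mul_of_nonneg_right (mul_le_of_le_one_right hD hA1) p2
  linarith

theorem abs_sum_sub_offZero_le {n s : ℕ} (T : Vec n → Vec s → ℝ) :
    |∑ h, ∑ c, T h c - ∑ h, ∑ c, offZero T h c| ≤ ∑ c, |T 0 c| + ∑ h, |T h 0| := by
  have h2 : ∑ h, ∑ c, (ind (h = 0) * |T 0 c| + ind (c = 0) * |T h 0|) =
      ∑ c, |T 0 c| + ∑ h, |T h 0| := by
    simp only [Finset.sum_add_distrib, ← Finset.mul_sum]
    rw [sum_ind_eq_mul 0 (fun _ => ∑ c, |T 0 c|)]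
    congr 1
    exact Finset.sum_congr rfl fun h _ => sum_ind_eq_mul 0 (fun _ => |T h 0|)
  rw [← h2, ← Finset.sum_sub_distrib]
  refine (Finset.abs_sum_le_sum_abs _ _).trans (Finset.sum_le_sum fun h _ => ?_)
  rw [← Finset.sum_sub_distrib]
  exact (Finset.abs_sum_le_sum_abs _ _).trans
    (Finset.sum_le_sum fun c _ => abs_sub_offZero_le T h c)

/-- The zero vector lies in every code, and contributes the additional term `1`. -/
theorem expect_sum_mem_code_le {n d : ℕ} (hd : d ≤ n) {F : Vec n → ℝ} (hF : ∀ x, 0 ≤ F x)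
    (hF1 : F 0 ≤ 1) :
    𝔼 C : Code n d, ∑ x, ind (x ∈ C.1) * F x ≤ 2 ^ d / 2 ^ n * ∑ x, F x + 1 := by
  have := nonempty_code hd
  have h1 : ∀ C : Code n d, ∑ x, ind (x ∈ C.1) * F x ≤
      ∑ x, ind (x ∈ C.1) * (ind (x ≠ 0) * F x) + 1 := fun C => by
    have h2 := sum_ind_eq_mul 0 (fun x => ind (x ∈ C.1) * F x)
    have h3 : ∑ x, ind (x ∈ C.1) * F x = ∑ x, ind (x ∈ C.1) * (ind (x ≠ 0) * F x) +
        ∑ x, ind (x = 0) * (ind (x ∈ C.1) * F x) := by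
      rw [← Finset.sum_add_distrib]
      refine Finset.sum_congr rfl fun x _ => ?_
      rw [Ne, ind_not]; ring
    rw [h3, h2, ind_of C.1.zero_mem, one_mul]
    linarith
  refine (Finset.expect_le_expect fun C _ => h1 C).trans ?_
  rw [Finset.expect_add_distrib, Fintype.expect_const, expect_sum_mem_code hd (by simp [ind])]
  refine add_le_add_left ?_ 1
  refine mul_le_mul (codeProb_le hd) (Finset.sum_le_sum fun x _ => ?_)
    (Finset.sum_nonneg fun x _ => mul_nonneg (ind_nonneg _) (hF x)) (by positivity)
  exact mul_le_of_le_one_left (hF x) (ind_le_one _)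

/-! ### Relations between the parameters -/

/-- The quantity that controls the failure probability of an iteration. -/
noncomputable def errTerm (n : ℕ) (q : Params) : ℝ :=
  (((n - q.s).choose q.w : ℝ) * (q.s.choose q.tAux : ℝ) / 2 ^ q.k +
    (q.s.choose q.tAux : ℝ) / (2 : ℝ) ^ ((q.s : ℤ) - (q.kAux : ℤ)) + 1) /
    (delta n q ^ 2 * expSamples n q)

theorem choose_pos_of_delta_pos {n : ℕ} {q : Params} (hδ : 0 < delta n q) :
    0 < ((n - q.s).choose q.w : ℝ) ∧ 0 < (q.s.choose q.tAux : ℝ) := by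
  refine ⟨?_, ?_⟩ <;> refine lt_of_le_of_ne (Nat.cast_nonneg _) fun h => ?_ <;>
    simp [delta, ← h] at hδ

theorem expSamples_pos {n : ℕ} {q : Params} (hδ : 0 < delta n q) : 0 < expSamples n q := by
  have h := choose_pos_of_delta_pos hδ
  exact div_pos (mul_pos h.1 h.2) (by positivity)

theorem delta_mul_eq {n : ℕ} {q : Params} (hδ : 0 < delta n q) :
    ((n - q.s).choose q.w : ℝ) * (q.s.choose q.tAux : ℝ) * delta n q =
      krawtchouk (n - q.s) q.w q.u * krawtchouk q.s q.tAux (q.t - q.u) := by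
  have h := choose_pos_of_delta_pos hδ
  rw [delta, mul_div_cancel₀ _ (mul_pos h.1 h.2).ne']

theorem delta_le_one {n : ℕ} {q : Params} (hq : Admissible n q) (hδ : 0 < delta n q) :
    delta n q ≤ 1 := by
  have h := choose_pos_of_delta_pos hδ
  rw [delta, div_le_one (mul_pos h.1 h.2)]
  refine (le_abs_self _).trans ?_
  rw [abs_mul]
  exact mul_le_mul (abs_krawtchouk_le _ hq.2.2.2.2.2) (abs_krawtchouk_le _ hq.2.2.2.2.1)
    (abs_nonneg _) h.1.le

theorem expSamples_eq (n : ℕ) (q : Params) :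
    expSamples n q = ((n - q.s).choose q.w : ℝ) * (q.s.choose q.tAux : ℝ) / 2 ^ q.k *
      2 ^ q.kAux := by
  rw [expSamples, zpow_sub₀ two_ne_zero, zpow_natCast, zpow_natCast]
  field_simp

theorem choose_div_zpow_eq (q : Params) :
    (q.s.choose q.tAux : ℝ) / (2 : ℝ) ^ ((q.s : ℤ) - (q.kAux : ℤ)) =
      q.s.choose q.tAux * (2 ^ q.kAux / 2 ^ q.s) := by
  rw [zpow_sub₀ two_ne_zero, zpow_natCast, zpow_natCast]
  field_simp

theorem two_pow_sub_div {n k : ℕ} (h : k ≤ n) : (2 : ℝ) ^ (n - k) / 2 ^ n = 1 / 2 ^ k := by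
  rw [pow_sub₀ _ two_ne_zero h]
  field_simp

/-- The decoder needs so many samples that the vectors of weight `u` on `𝒩` are few compared to the
syndromes of the code. -/
theorem choose_mul_delta_sq_mul_expSamples_le {n : ℕ} {q : Params} (hq : Admissible n q)
    (hδ : 0 < delta n q) :
    ((n - q.s).choose q.u : ℝ) * (delta n q ^ 2 * expSamples n q) ≤
      2 ^ (n - q.k) * ((q.s.choose q.tAux : ℝ) / (2 : ℝ) ^ ((q.s : ℤ) - (q.kAux : ℤ))) := by
  have hpos := choose_pos_of_delta_pos hδ
  have hmul := delta_mul_eq hδ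
  rw [choose_div_zpow_eq, expSamples_eq]
  have hK := choose_mul_krawtchouk_sq_le (n - q.s) q.w q.u
  have hK' : krawtchouk q.s q.tAux (q.t - q.u) ^ 2 ≤ (q.s.choose q.tAux : ℝ) ^ 2 :=
    sq_le_sq' (abs_le.mp (abs_krawtchouk_le _ hq.2.2.2.2.1)).1
      (abs_le.mp (abs_krawtchouk_le _ hq.2.2.2.2.1)).2
  set W : ℝ := ((n - q.s).choose q.w : ℝ)
  set B : ℝ := (q.s.choose q.tAux : ℝ)
  set U : ℝ := ((n - q.s).choose q.u : ℝ)
  set d := delta n q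
  have hU : (0 : ℝ) ≤ U := Nat.cast_nonneg _
  have h1 : U * W * d ^ 2 ≤ 2 ^ (n - q.s) := by
    have hWB : 0 < W * B ^ 2 := mul_pos hpos.1 (pow_pos hpos.2 2)
    refine le_of_mul_le_mul_right ?_ hWB
    calc U * W * d ^ 2 * (W * B ^ 2) = U * (W * B * d) ^ 2 := by ring
      _ = U * krawtchouk (n - q.s) q.w q.u ^ 2 * krawtchouk q.s q.tAux (q.t - q.u) ^ 2 := by
        rw [hmul]; ring
      _ ≤ 2 ^ (n - q.s) * W * B ^ 2 :=
        mul_le_mul hK hK' (sq_nonneg _) (mul_nonneg (by positivity) hpos.1.le)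
      _ = 2 ^ (n - q.s) * (W * B ^ 2) := by ring
  have hsn : q.s ≤ n := hq.2.1.trans hq.2.2.1
  have h2 : (2 : ℝ) ^ (n - q.s) / 2 ^ q.k = 2 ^ (n - q.k) / 2 ^ q.s := by
    rw [pow_sub₀ _ two_ne_zero hsn, pow_sub₀ _ two_ne_zero hq.2.2.1]
    field_simp
  calc U * (d ^ 2 * (W * B / 2 ^ q.k * 2 ^ q.kAux))
      = U * W * d ^ 2 * (B * 2 ^ q.kAux / 2 ^ q.k) := by ring
    _ ≤ 2 ^ (n - q.s) * (B * 2 ^ q.kAux / 2 ^ q.k) :=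
      mul_le_mul_of_nonneg_right h1 (div_nonneg (mul_nonneg hpos.2.le (by positivity))
        (by positivity))
    _ = (2 ^ (n - q.s) / 2 ^ q.k) * (B * 2 ^ q.kAux) := by ring
    _ = 2 ^ (n - q.k) * (B * (2 ^ q.kAux / 2 ^ q.s)) := by rw [h2]; ring

theorem errTerm_pos {n : ℕ} {q : Params} (hδ : 0 < delta n q) : 0 < errTerm n q :=
  div_pos (by positivity) (mul_pos (pow_pos hδ 2) (expSamples_pos hδ))

theorem errTerm_mul {n : ℕ} {q : Params} (hδ : 0 < delta n q) :
    errTerm n q * (delta n q ^ 2 * expSamples n q) =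
      ((n - q.s).choose q.w : ℝ) * (q.s.choose q.tAux : ℝ) / 2 ^ q.k +
        (q.s.choose q.tAux : ℝ) / (2 : ℝ) ^ ((q.s : ℤ) - (q.kAux : ℤ)) + 1 :=
  div_mul_cancel₀ _ (mul_pos (pow_pos hδ 2) (expSamples_pos hδ)).ne'

/-- Few vectors share with `e` their restriction to the complement of `𝒩` and the weight `u` on `𝒩`,
compared to the number of syndromes. -/
theorem choose_le_errTerm_mul {n : ℕ} {q : Params} (hq : Admissible n q) (hδ : 0 < delta n q) :
    ((n - q.s).choose q.u : ℝ) ≤ errTerm n q * 2 ^ (n - q.k) := by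
  have hpos := mul_pos (pow_pos hδ 2) (expSamples_pos hδ)
  refine le_of_mul_le_mul_right ((choose_mul_delta_sq_mul_expSamples_le hq hδ).trans ?_) hpos
  rw [mul_right_comm, errTerm_mul hδ, mul_comm]
  refine mul_le_mul_of_nonneg_right ?_ (by positivity)
  have : 0 ≤ ((n - q.s).choose q.w : ℝ) * (q.s.choose q.tAux : ℝ) / 2 ^ q.k := by positivity
  linarith

theorem one_le_errTerm_mul_two_pow_sub {n : ℕ} {q : Params} (hq : Admissible n q)
    (hδ : 0 < delta n q) : 1 ≤ errTerm n q * 2 ^ (n - q.k) := by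
  refine le_trans ?_ (choose_le_errTerm_mul hq hδ)
  exact_mod_cast Nat.choose_pos hq.2.2.2.2.2

theorem one_le_errTerm_mul_two_pow_kAux {n : ℕ} {q : Params} (hq : Admissible n q)
    (hδ : 0 < delta n q) : 1 ≤ errTerm n q * 2 ^ q.kAux := by
  have hpos := mul_pos (pow_pos hδ 2) (expSamples_pos hδ)
  refine le_of_mul_le_mul_right ?_ hpos
  rw [mul_right_comm, errTerm_mul hδ, one_mul]
  have h1 : delta n q ^ 2 * expSamples n q ≤ expSamples n q :=
    mul_le_of_le_one_left (expSamples_pos hδ).le (pow_le_one₀ hδ.le (delta_le_one hq hδ))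
  refine h1.trans ?_
  rw [expSamples_eq]
  refine mul_le_mul_of_nonneg_right ?_ (by positivity)
  have : 0 ≤ (q.s.choose q.tAux : ℝ) / (2 : ℝ) ^ ((q.s : ℤ) - (q.kAux : ℤ)) := by positivity
  linarith

/-! ### The second moment of the score -/

section Score

variable {n : ℕ} {q : Params} (hq : Admissible n q) (hδ : 0 < delta n q) {e : Vec n}
  {N : PosSet n q.s} (hN : weightN N e = q.u) (hP : hammingNorm (restrictP N e) = q.t - q.u)

include hq hδ in
/-- The variance of the score, with the pairs of distinct samples that share a parity-check or an
auxiliary codeword as the dominant contributions. -/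
theorem variance_offZero_scoreKernel_le :
    (𝔼 x : Code n (n - q.k) × Code q.s q.kAux,
        pairSum (offZero (scoreKernel N e q.w q.tAux)) x ^ 2) -
      (𝔼 x : Code n (n - q.k) × Code q.s q.kAux,
        pairSum (offZero (scoreKernel N e q.w q.tAux)) x) ^ 2 ≤
      expSamples n q * (errTerm n q * (delta n q ^ 2 * expSamples n q)) := by
  have hpos := choose_pos_of_delta_pos hδ
  have ha₁0 := codeProb_nonneg n (n - q.k)
  have ha₂0 := codeProb_nonneg q.s q.kAux
  have ha₁ := codeProb_le (Nat.sub_le n q.k)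
  have ha₂ := codeProb_le hq.1
  rw [two_pow_sub_div hq.2.2.1] at ha₁
  set T := offZero (scoreKernel N e q.w q.tAux) with hT
  have hT0 : ∀ c, T 0 c = 0 := fun c => by simp [hT, offZero, ind]
  have hT0' : ∀ h, T h 0 = 0 := fun h => by simp [hT, offZero, ind]
  have h2 := expect_pairSum_sq_le (Nat.sub_le n q.k) hq.1 hT0 hT0'
  rw [expect_pairSum (Nat.sub_le n q.k) hq.1 hT0 hT0', errTerm_mul hδ, choose_div_zpow_eq,
    expSamples_eq]
  set a₁ := codeProb n (n - q.k)
  set a₂ := codeProb q.s q.kAux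
  set W : ℝ := ((n - q.s).choose q.w : ℝ)
  set B : ℝ := (q.s.choose q.tAux : ℝ)
  have habs : ∀ h c, |T h c| ≤ |scoreKernel N e q.w q.tAux h c| := abs_offZero_le _
  have hrow : ∑ h, (∑ c, T h c) ^ 2 ≤ 2 ^ q.s * (W * B ^ 2) := by
    have h3 : ∀ h, (∑ c, T h c) ^ 2 ≤ ind (hammingNorm (restrictN N h) = q.w) * B ^ 2 := fun h => by
      rw [← ind_mul_self, ← sq, ← mul_pow, ← sum_abs_scoreKernel_row N e, ← sq_abs]
      refine pow_le_pow_left₀ (abs_nonneg _) ?_ 2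
      exact (Finset.abs_sum_le_sum_abs _ _).trans (Finset.sum_le_sum fun c _ => habs h c)
    refine (Finset.sum_le_sum fun h _ => h3 h).trans ?_
    rw [← Finset.sum_mul, sum_restrictN N (fun x => ind (hammingNorm x = q.w)), sum_sphere,
      mul_assoc]
  have hcol : ∑ c, (∑ h, T h c) ^ 2 ≤ 2 ^ q.s * (W * B) ^ 2 := by
    have h3 : ∀ c, (∑ h, T h c) ^ 2 ≤ (W * B) ^ 2 := fun c => by
      rw [← sum_abs_scoreKernel_column N e q.w q.tAux c, ← sq_abs]
      refine pow_le_pow_left₀ (abs_nonneg _) ?_ 2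
      exact (Finset.abs_sum_le_sum_abs _ _).trans (Finset.sum_le_sum fun h _ => habs h c)
    refine (Finset.sum_le_sum fun c _ => h3 c).trans ?_
    simp
  have hsq : ∑ h, ∑ c, T h c ^ 2 ≤ 2 ^ q.s * (W * B) := by
    have h3 : ∀ h c, T h c ^ 2 ≤ |scoreKernel N e q.w q.tAux h c| := fun h c => by
      have := habs h c
      have := abs_scoreKernel_le_one N e q.w q.tAux h c
      have := abs_nonneg (T h c)
      rw [← sq_abs]; nlinarith
    rw [Finset.sum_comm]
    refine (Finset.sum_le_sum fun c _ => (Finset.sum_le_sum fun h _ => h3 h c).trans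
      (sum_abs_scoreKernel_column N e q.w q.tAux c).le).trans ?_
    simp [W, B]
  have hW := hpos.1.le
  have hB := hpos.2.le
  have e1 : a₁ * a₂ ^ 2 * ∑ h, (∑ c, T h c) ^ 2 ≤
      (1 / 2 ^ q.k) * (2 ^ q.kAux / 2 ^ q.s) ^ 2 * (2 ^ q.s * (W * B ^ 2)) := by gcongr
  have e2 : a₁ ^ 2 * a₂ * ∑ c, (∑ h, T h c) ^ 2 ≤
      (1 / 2 ^ q.k) ^ 2 * (2 ^ q.kAux / 2 ^ q.s) * (2 ^ q.s * (W * B) ^ 2) := by gcongr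
  have e3 : a₁ * a₂ * ∑ h, ∑ c, T h c ^ 2 ≤
      (1 / 2 ^ q.k) * (2 ^ q.kAux / 2 ^ q.s) * (2 ^ q.s * (W * B)) := by gcongr
  have e4 : (1 / 2 ^ q.k) * (2 ^ q.kAux / 2 ^ q.s) ^ 2 * (2 ^ q.s * (W * B ^ 2)) +
      (1 / 2 ^ q.k) ^ 2 * (2 ^ q.kAux / 2 ^ q.s) * (2 ^ q.s * (W * B) ^ 2) +
      (1 / 2 ^ q.k) * (2 ^ q.kAux / 2 ^ q.s) * (2 ^ q.s * (W * B)) =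
      W * B / 2 ^ q.k * 2 ^ q.kAux * (W * B / 2 ^ q.k + B * (2 ^ q.kAux / 2 ^ q.s) + 1) := by
    field_simp
    ring
  linarith

include hq hδ hN hP in
/-- If the failure bound is nontrivial, then the mean score is close to `δ H̃`. -/
theorem le_expect_offZero_scoreKernel (hε : 80 * errTerm n q ≤ 1) :
    3 / 4 * (delta n q * expSamples n q) ≤ 𝔼 x : Code n (n - q.k) × Code q.s q.kAux,
      pairSum (offZero (scoreKernel N e q.w q.tAux)) x := by
  have hpos := choose_pos_of_delta_pos hδ
  have ha₁0 := codeProb_nonneg n (n - q.k)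
  have ha₂0 := codeProb_nonneg q.s q.kAux
  have ha₁ := codeProb_le (Nat.sub_le n q.k)
  have ha₂ := codeProb_le hq.1
  have ha₁' := le_codeProb (Nat.sub_le n q.k)
  have ha₂' := le_codeProb hq.1
  have hxk := two_pow_sub_div hq.2.2.1
  rw [hxk] at ha₁
  rw [sub_div, hxk] at ha₁'
  rw [sub_div] at ha₂'
  have hsum := sum_scoreKernel N e q.w q.tAux
  rw [hN, hP, ← delta_mul_eq hδ] at hsum
  have hdiff := abs_sum_sub_offZero_le (scoreKernel N e q.w q.tAux)
  rw [sum_abs_scoreKernel_row, sum_abs_scoreKernel_column, hsum] at hdiff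
  have hβ := errTerm_mul hδ
  rw [choose_div_zpow_eq] at hβ
  have hD := one_le_errTerm_mul_two_pow_sub hq hδ
  have hK := one_le_errTerm_mul_two_pow_kAux hq hδ
  have hε0 := errTerm_pos hδ
  have hδ1 := delta_le_one hq hδ
  have hH := expSamples_pos hδ
  rw [expect_pairSum (Nat.sub_le n q.k) hq.1 (fun c => by simp [offZero, ind])
    (fun h => by simp [offZero, ind])]
  have hHe := expSamples_eq n q
  set H := expSamples n q
  set ε := errTerm n q
  set d := delta n q
  set a₁ := codeProb n (n - q.k)
  set a₂ := codeProb q.s q.kAux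
  set W : ℝ := ((n - q.s).choose q.w : ℝ)
  set B : ℝ := (q.s.choose q.tAux : ℝ)
  set S' := ∑ h, ∑ c, offZero (scoreKernel N e q.w q.tAux) h c
  set x : ℝ := 1 / 2 ^ q.k with hx
  set y : ℝ := 2 ^ q.kAux / 2 ^ q.s with hy
  have hx0 : 0 < x := by positivity
  have hy0 : 0 < y := by positivity
  have hx1 : x ≤ 1 := by
    rw [hx, div_le_one (by positivity)]; exact one_le_pow₀ one_le_two
  have hy1 : y ≤ 1 := by
    rw [hy, div_le_one (by positivity)]; exact pow_le_pow_right₀ one_le_two hq.1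
  -- both codes are large: being nonzero changes the probability of membership by `1 / 80` at most
  have h80 : ∀ z : ℝ, 0 < z → 1 ≤ ε * z → 80 ≤ z := fun z hz h => by nlinarith
  have hD80 : (80 : ℝ) ≤ 2 ^ (n - q.k) := h80 _ (by positivity) hD
  have hK80 : (80 : ℝ) ≤ 2 ^ q.kAux := h80 _ (by positivity) hK
  have ha₁8 : 79 / 80 * x ≤ a₁ := by
    refine le_trans ?_ ha₁'
    have : (1 : ℝ) / 2 ^ n = x / 2 ^ (n - q.k) := by
      rw [← hxk]; field_simp
    rw [this]
    have : x / 2 ^ (n - q.k) ≤ x / 80 := div_le_div_of_nonneg_left hx0.le (by norm_num) hD80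
    linarith
  have ha₂8 : 79 / 80 * y ≤ a₂ := by
    refine le_trans ?_ ha₂'
    have : (1 : ℝ) / 2 ^ q.s = y / 2 ^ q.kAux := by
      rw [hy]; field_simp
    rw [this]
    have : y / 2 ^ q.kAux ≤ y / 80 := div_le_div_of_nonneg_left hy0.le (by norm_num) hK80
    linarith
  have haa : (79 / 80 * x) * (79 / 80 * y) ≤ a₁ * a₂ :=
    mul_le_mul ha₁8 ha₂8 (by positivity) ha₁0
  have haa' : a₁ * a₂ ≤ x * y := mul_le_mul ha₁ ha₂ ha₂0 hx0.le
  have hWB := mul_pos hpos.1 hpos.2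
  have hxyH : x * y * (2 ^ q.s * (W * B * d)) = d * H := by
    rw [hHe, hx, hy]; field_simp
  have hS0 : 0 ≤ 2 ^ q.s * (W * B * d) := by positivity
  have hmain := mul_le_mul_of_nonneg_right haa hS0
  have hS'le : 2 ^ q.s * (W * B * d) - (B + W * B) ≤ S' := by
    have h1 := (abs_le.mp hdiff).2
    have h2 : ind (hammingNorm (restrictN N (0 : Vec n)) = q.w) * B ≤ B :=
      mul_le_of_le_one_left hpos.2.le (ind_le_one _)
    linarith
  have haa0 : 0 ≤ a₁ * a₂ := mul_nonneg ha₁0 ha₂0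
  have h5 := mul_le_mul_of_nonneg_left hS'le haa0
  have h6 : a₁ * a₂ * (B + W * B) ≤ B * y + W * B * x := by
    have h7 : a₁ * a₂ * B ≤ B * y := by
      have : x * y * B ≤ 1 * y * B := by gcongr
      have := mul_le_mul_of_nonneg_right haa' hpos.2.le
      linarith
    have h8 : a₁ * a₂ * (W * B) ≤ W * B * x := by
      have : x * y * (W * B) ≤ x * 1 * (W * B) := by gcongr
      have := mul_le_mul_of_nonneg_right haa' hWB.le
      linarith
    linarith
  -- by the smallness of `errTerm`, the zero vectors account for at most `δ H̃ / 80` of the mean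
  have h9 : B * y + W * B * x ≤ 1 / 80 * (d * H) := by
    have h10 : W * B / 2 ^ q.k = W * B * x := by rw [hx]; ring
    rw [h10] at hβ
    have h11 : d ^ 2 * H ≤ d * H := mul_le_mul_of_nonneg_right (by nlinarith) hH.le
    have h12 : 0 ≤ d ^ 2 * H := mul_nonneg (sq_nonneg d) hH.le
    have h13 : ε * (d ^ 2 * H) ≤ 1 / 80 * (d * H) :=
      mul_le_mul (by linarith) h11 h12 (by norm_num)
    linarith
  have hdH : 0 < d * H := mul_pos hδ hH
  have h14 : (79 / 80) ^ 2 * (d * H) ≤ a₁ * a₂ * (2 ^ q.s * (W * B * d)) := by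
    rw [← hxyH]
    refine le_trans (le_of_eq ?_) hmain
    ring
  rw [mul_sub] at h5
  linarith

include hq hδ hN hP in
/-- If the error has the expected weights on `𝒩` and its complement, then the score of the right
candidate passes the threshold `δ H̃ / 2`, except with probability `O(errTerm)`. -/
theorem prob_pairSum_lt_le :
    prob (Code n (n - q.k) × Code q.s q.kAux) (fun x =>
      pairSum (scoreKernel N e q.w q.tAux) x < delta n q / 2 * expSamples n q) ≤
      80 * errTerm n q := by
  by_cases hε : 1 < 80 * errTerm n q
  · exact (prob_le_one _).trans hε.le
  have hmean := le_expect_offZero_scoreKernel hq hδ hN hP (not_lt.mp hε)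
  have hvar := variance_offZero_scoreKernel_le hq hδ (e := e) (N := N)
  have := nonempty_code (Nat.sub_le n q.k)
  have := nonempty_code hq.1
  have hε0 := errTerm_pos hδ
  have hδ1 := delta_le_one hq hδ
  have hH := expSamples_pos hδ
  have hβ := errTerm_mul hδ
  set K := scoreKernel N e q.w q.tAux
  -- `Y` dominates the contribution of the samples with `h = 0` or `c = 0`
  set Y : Code n (n - q.k) × Code q.s q.kAux → ℝ := fun x =>
    ∑ c, ind (c ∈ x.2.1) * |K 0 c| + ∑ h, ind (h ∈ x.1.1) * |K h 0| with hY
  have hY0 : ∀ x, 0 ≤ Y x := fun x => add_nonneg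
    (Finset.sum_nonneg fun c _ => mul_nonneg (ind_nonneg _) (abs_nonneg _))
    (Finset.sum_nonneg fun c _ => mul_nonneg (ind_nonneg _) (abs_nonneg _))
  have hEY : 𝔼 x, Y x ≤ 2 * (errTerm n q * (delta n q ^ 2 * expSamples n q)) := by
    simp only [hY, expect_prod, Finset.expect_add_distrib, Fintype.expect_const]
    have h1 := expect_sum_mem_code_le hq.1 (F := fun c => |K 0 c|) (fun c => abs_nonneg _)
      (abs_scoreKernel_le_one _ _ _ _ _ _)
    have h2 := expect_sum_mem_code_le (Nat.sub_le n q.k) (F := fun h => |K h 0|)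
      (fun c => abs_nonneg _) (abs_scoreKernel_le_one _ _ _ _ _ _)
    rw [sum_abs_scoreKernel_row] at h1
    rw [sum_abs_scoreKernel_column, two_pow_sub_div hq.2.2.1, one_div_mul_eq_div] at h2
    have h3 : 2 ^ q.kAux / 2 ^ q.s *
        (ind (hammingNorm (restrictN N (0 : Vec n)) = q.w) * (q.s.choose q.tAux : ℝ)) ≤
        (q.s.choose q.tAux : ℝ) * (2 ^ q.kAux / 2 ^ q.s) := by
      rw [mul_comm]
      refine mul_le_mul_of_nonneg_right ?_ (by positivity)
      exact mul_le_of_le_one_left (by positivity) (ind_le_one _)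
    rw [hβ, choose_div_zpow_eq]
    have h4 : 0 ≤ ((n - q.s).choose q.w : ℝ) * (q.s.choose q.tAux : ℝ) / 2 ^ q.k := by positivity
    have h5 : 0 ≤ (q.s.choose q.tAux : ℝ) * (2 ^ q.kAux / 2 ^ q.s) := by positivity
    linarith
  set M := delta n q * expSamples n q with hM
  have hM0 : 0 < M := mul_pos hδ hH
  have hτ : 0 < M / 8 := by linarith
  have hcheb := prob_le_sub_le (pairSum (d₁ := n - q.k) (d₂ := q.kAux) (offZero K)) hτ
  have hmark := prob_le_expect_div hY0 hτ
  refine (prob_mono (F := fun x => pairSum (offZero K) x ≤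
    (𝔼 x : Code n (n - q.k) × Code q.s q.kAux, pairSum (offZero K) x) - M / 8 ∨ M / 8 ≤ Y x)
    fun x hx => ?_).trans ((prob_or_le _ _).trans ((add_le_add hcheb hmark).trans ?_))
  · by_contra! hc
    have h1 := (abs_le.mp (abs_pairSum_sub_offZero_le K x.1 x.2)).1
    have h2 : delta n q / 2 * expSamples n q = M / 2 := by rw [hM]; ring
    have h3 := hc.1
    have h4 := hc.2
    rw [h2] at hx
    change -(Y x) ≤ pairSum K x - pairSum (offZero K) x at h1
    linarith
  · -- Chebyshev's inequality contributes `64 errTerm` and Markov's inequality `16 errTerm`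
    have h1 : expSamples n q * (errTerm n q * (delta n q ^ 2 * expSamples n q)) / (M / 8) ^ 2 =
        64 * errTerm n q := by
      rw [hM]; field_simp; norm_num
    have h2 : 2 * (errTerm n q * (delta n q ^ 2 * expSamples n q)) / (M / 8) ≤
        16 * errTerm n q := by
      rw [div_le_iff₀ hτ]
      have : delta n q ^ 2 * expSamples n q ≤ M := by
        rw [hM, sq, mul_assoc]; exact mul_le_of_le_one_left hM0.le hδ1
      nlinarith
    have h3 := div_le_div_of_nonneg_right hvar (sq_nonneg (M / 8))
    have h4 := div_le_div_of_nonneg_right hEY hτ.le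
    linarith

end Score

/-! ### Correctness of an iteration -/

theorem add_sub_mem_iff {n k : ℕ} {C : Code n k} {c₀ e e' : Vec n} (hc₀ : c₀ ∈ C.1) :
    c₀ + e - e' ∈ C.1 ↔ e - e' ∈ C.1 := by
  rw [add_sub_assoc]
  exact Submodule.add_mem_iff_right _ hc₀

theorem solveSubProblem_eq_some {n s k : ℕ} {C : Code n k} {N : PosSet n s} {y : Vec n} {v : Vec s}
    {u : ℕ} {x : Vec n} (h : solveSubProblem C N y v u = some x) :
    y - x ∈ C.1 ∧ restrictP N x = v ∧ weightN N x = u := by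
  unfold solveSubProblem at h
  split_ifs at h with hex
  rw [← Option.some.inj h]
  exact hex.choose_spec

theorem mem_decodeDumer {ι : Type} {m : ℕ} {H : Matrix ι (Fin m) (ZMod 2)} {σ : ι → ZMod 2} {τ : ℕ}
    {v : Vec m} : v ∈ decodeDumer H σ τ ↔ H.mulVec v = σ ∧ hammingNorm v = τ := by
  simp [decodeDumer]

theorem of_mem_foundErrors {n : ℕ} {q : Params} {y : Vec n} {C : Code n q.k} {ρ : Iter n q}
    {x : Vec n} (h : x ∈ foundErrors q y C ρ) :
    y - x ∈ C.1 ∧ hammingNorm (restrictP ρ.1 x) = q.t - q.u ∧ weightN ρ.1 x = q.u := by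
  simp only [foundErrors, recoverAll, List.mem_flatMap, List.mem_filterMap, mem_decodeDumer] at h
  obtain ⟨σ, -, v, ⟨-, hv⟩, hx⟩ := h
  obtain ⟨h1, h2, h3⟩ := solveSubProblem_eq_some hx
  exact ⟨h1, h2 ▸ hv, h3⟩

/-- The event that makes an iteration successful, apart from the weight of `e` on `𝒩`: the right
candidates pass the threshold, and `e` is the only solution of the decoding problem that satisfies
`R`. -/
def IterOk {n : ℕ} (q : Params) (hk : q.k ≤ n) (e : Vec n) (R : PosSet n q.s → Vec n → Prop)
    (C : Code n q.k) (N : PosSet n q.s) (A : Fin q.nAux → Code q.s q.kAux) : Prop :=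
  (∀ j, delta n q / 2 * expSamples n q ≤ pairSum (scoreKernel N e q.w q.tAux)
    (dualEquiv (Nat.add_sub_cancel' hk) C, A j)) ∧
  ∀ x, R N x → e - x ∈ C.1 → x = e

theorem mem_foundErrors {n : ℕ} {q : Params} (hk : q.k ≤ n) {C : Code n q.k} {c₀ e : Vec n}
    (hc₀ : c₀ ∈ C.1) {ρ : Iter n q} {R : PosSet n q.s → Vec n → Prop}
    (hR : ∀ x, restrictP ρ.1 x = restrictP ρ.1 e → weightN ρ.1 x = q.u → R ρ.1 x)
    (hN : weightN ρ.1 e = q.u) (hP : hammingNorm (restrictP ρ.1 e) = q.t - q.u)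
    (hok : IterOk q hk e R C ρ.1 ρ.2) : e ∈ foundErrors q (c₀ + e) C ρ := by
  simp only [foundErrors, recoverAll, List.mem_flatMap, List.mem_filterMap, mem_decodeDumer,
    Finset.mem_toList, Fintype.mem_piFinset]
  refine ⟨fun j => (genMatrix (ρ.2 j)).mulVec (restrictP ρ.1 e), fun j => ?_, restrictP ρ.1 e,
    ⟨rfl, hP⟩, ?_⟩
  · rw [fftDecode, Finset.mem_filter]
    refine ⟨Finset.mem_univ _, ?_⟩
    rw [fourier_lpnFun_eq q hk C ρ.1 (ρ.2 j) hc₀ e]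
    exact hok.1 j
  · have hex : ∃ x : Vec n, c₀ + e - x ∈ C.1 ∧ restrictP ρ.1 x = restrictP ρ.1 e ∧
        weightN ρ.1 x = q.u := ⟨e, by simpa using hc₀, rfl, hN⟩
    rw [solveSubProblem, dif_pos hex]
    obtain ⟨h1, h2, h3⟩ := hex.choose_spec
    rw [hok.2 _ (hR _ h2 h3) ((add_sub_mem_iff hc₀).mp h1)]

theorem head?_eq_some_of_forall_eq {α : Type*} {l : List α} {a : α} (ha : a ∈ l)
    (h : ∀ b ∈ l, b = a) : l.head? = some a := by
  cases l with
  | nil => simp at ha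
  | cons b l => rw [List.head?_cons, h b (by simp)]

/-! ### Uniqueness of the solution -/

theorem prob_exists_solution_le {n k : ℕ} (hk : k ≤ n) (e : Vec n) (R : Vec n → Prop) :
    prob (Code n k) (fun C => ∃ x, R x ∧ x ≠ e ∧ e - x ∈ C.1) ≤ (∑ x, ind (R x)) / 2 ^ (n - k) := by
  classical
  let S := (Finset.univ.filter fun x => R x ∧ x ≠ e).image fun x => e - x
  have h0 : (0 : Vec n) ∉ S := by
    simp only [S, Finset.mem_image, Finset.mem_filter, Finset.mem_univ, true_and, not_exists,
      not_and]
    intro x hx h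
    exact hx.2 (sub_eq_zero.mp h).symm
  have hcard : (S.card : ℝ) ≤ ∑ x, ind (R x) := by
    rw [sum_ind_eq_card]
    refine Nat.cast_le.mpr (Finset.card_image_le.trans (Finset.card_le_card fun x hx => ?_))
    simp only [Finset.mem_filter] at hx ⊢
    exact ⟨hx.1, hx.2.1⟩
  have h2 : (2 : ℝ) ^ k / 2 ^ n = 1 / 2 ^ (n - k) := by
    rw [pow_sub₀ _ two_ne_zero hk]; field_simp
  refine (prob_mono fun C hC => ?_).trans ((prob_exists_mem_code_le hk S h0).trans ?_)
  · obtain ⟨x, hx, hxe, hxC⟩ := hC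
    exact ⟨e - x, Finset.mem_image.mpr ⟨x, by simp [hx, hxe], rfl⟩, hxC⟩
  · rw [h2, mul_one_div]
    exact div_le_div_of_nonneg_right hcard (by positivity)

theorem sum_ind_restrictP_weightN {n s : ℕ} (N : PosSet n s) (Q : Vec s → Prop) (u : ℕ) :
    ∑ x : Vec n, ind (Q (restrictP N x) ∧ weightN N x = u) =
      (∑ z, ind (Q z)) * ((n - s).choose u : ℝ) := by
  simp only [weightN_eq]
  have := Equiv.sum_comp (splitEquiv N) (fun x => ind (Q x.2 ∧ hammingNorm x.1 = u))
  simp only [splitEquiv_apply] at this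
  rw [this, Fintype.sum_prod_type, ← sum_sphere, Finset.sum_mul_sum, Finset.sum_comm]
  simp only [ind_and]

theorem sum_ind_restrictP_eq {n s : ℕ} (N : PosSet n s) (e : Vec n) (u : ℕ) :
    ∑ x : Vec n, ind (restrictP N x = restrictP N e ∧ weightN N x = u) =
      ((n - s).choose u : ℝ) := by
  rw [sum_ind_restrictP_weightN N (fun z => z = restrictP N e)]
  have := sum_ind_eq_mul (restrictP N e) (fun _ => 1)
  simp only [mul_one] at this
  rw [this, one_mul]

theorem sum_ind_hammingNorm_restrictP {n s : ℕ} (N : PosSet n s) (a u : ℕ) :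
    ∑ x : Vec n, ind (hammingNorm (restrictP N x) = a ∧ weightN N x = u) =
      (s.choose a : ℝ) * ((n - s).choose u : ℝ) := by
  rw [sum_ind_restrictP_weightN N (fun z => hammingNorm z = a), sum_sphere]

/-- The failure probability of an iteration whose set `𝒩` splits the error as expected. -/
theorem prob_not_iterOk_le {n : ℕ} {q : Params} (hq : Admissible n q) (hδ : 0 < delta n q)
    {e : Vec n} {N : PosSet n q.s} (hN : weightN N e = q.u)
    (hP : hammingNorm (restrictP N e) = q.t - q.u) (R : PosSet n q.s → Vec n → Prop) :
    prob (Code n q.k × (Fin q.nAux → Code q.s q.kAux))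
      (fun x => ¬IterOk q hq.2.2.1 e R x.1 N x.2) ≤
      q.nAux * (80 * errTerm n q) + (∑ x, ind (R N x)) / 2 ^ (n - q.k) := by
  have := nonempty_code hq.1
  have hthr : ∀ j : Fin q.nAux, prob (Code n q.k × (Fin q.nAux → Code q.s q.kAux))
      (fun x => pairSum (scoreKernel N e q.w q.tAux)
        (dualEquiv (Nat.add_sub_cancel' hq.2.2.1) x.1, x.2 j) <
          delta n q / 2 * expSamples n q) ≤ 80 * errTerm n q := fun j => by
    refine le_of_eq_of_le ?_ (prob_pairSum_lt_le hq hδ hN hP)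
    rw [← prob_comp_equiv ((dualEquiv (Nat.add_sub_cancel' hq.2.2.1)).prodCongr
      (Equiv.refl (Code q.s q.kAux))), prob_prod, prob_prod]
    refine Finset.expect_congr rfl fun C _ => ?_
    exact prob_pi_eval j (fun A => pairSum (scoreKernel N e q.w q.tAux)
      (dualEquiv (Nat.add_sub_cancel' hq.2.2.1) C, A) < delta n q / 2 * expSamples n q)
  have huniq := (prob_fst (Ω' := Fin q.nAux → Code q.s q.kAux) _).trans_le
    (prob_exists_solution_le hq.2.2.1 e (R N))
  have hunion := (prob_exists_le Finset.univ _).trans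
    (Finset.sum_le_card_nsmul _ _ _ fun j _ => hthr j)
  rw [Finset.card_univ, Fintype.card_fin, nsmul_eq_mul] at hunion
  refine (prob_mono fun x hx => ?_).trans ((prob_or_le _ _).trans (add_le_add hunion huniq))
  by_contra! hc
  refine hx ⟨fun j => hc.1 j (Finset.mem_univ j), fun y hy hyC => ?_⟩
  by_contra hne
  exact hc.2 y hy hne hyC

/-! ### The weight of the error on a random set of positions -/

theorem card_posSet_eq {n s : ℕ} (hs : s ≤ n) : Nat.card (PosSet n s) = n.choose (n - s) := by
  rw [← Nat.card_congr (Equiv.subtypeEquivRight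
    (p := fun N : Finset (Fin n) => N.card = n - s) (q := fun N => N.card + s = n)
    fun N => by omega), Nat.card_eq_fintype_card, Fintype.card_finset_len, Fintype.card_fin]

theorem nonempty_posSet {n s : ℕ} (hs : s ≤ n) : Nonempty (PosSet n s) := by
  have := card_posSet_eq hs
  have h : 0 < n.choose (n - s) := Nat.choose_pos (Nat.sub_le n s)
  rw [← this] at h
  exact (Nat.card_pos_iff.mp h).1

theorem choose_mul_choose_le_card {n s u : ℕ} (hs : s ≤ n) (hu : u ≤ n - s) (e : Vec n) :
    (hammingNorm e).choose u * (n - hammingNorm e).choose (n - s - u) ≤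
      Nat.card {N : PosSet n s // weightN N e = u} := by
  classical
  let S : Finset (Fin n) := Finset.univ.filter fun i => e i ≠ 0
  have hS : S.card = hammingNorm e := rfl
  have hmem : ∀ x : Finset.powersetCard u S × Finset.powersetCard (n - s - u) Sᶜ,
      Disjoint x.1.1 x.2.1 ∧ x.1.1 ⊆ S ∧ x.2.1 ⊆ Sᶜ ∧ x.1.1.card = u ∧
        x.2.1.card = n - s - u := fun x => by
    have h1 := Finset.mem_powersetCard.mp x.1.2
    have h2 := Finset.mem_powersetCard.mp x.2.2
    exact ⟨Finset.disjoint_of_subset_left h1.1 (Finset.disjoint_of_subset_right h2.1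
      disjoint_compl_right), h1.1, h2.1, h1.2, h2.2⟩
  have hinter : ∀ x : Finset.powersetCard u S × Finset.powersetCard (n - s - u) Sᶜ,
      (x.1.1 ∪ x.2.1) ∩ S = x.1.1 ∧ (x.1.1 ∪ x.2.1) ∩ Sᶜ = x.2.1 := fun x => by
    obtain ⟨-, h1, h2, -, -⟩ := hmem x
    constructor
    · rw [Finset.union_inter_distrib_right, Finset.inter_eq_left.mpr h1,
        Finset.disjoint_iff_inter_eq_empty.mp
          (Finset.disjoint_of_subset_left h2 disjoint_compl_left), Finset.union_empty]
    · rw [Finset.union_inter_distrib_right, Finset.inter_eq_left.mpr h2,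
        Finset.disjoint_iff_inter_eq_empty.mp
          (Finset.disjoint_of_subset_left h1 disjoint_compl_right), Finset.empty_union]
  let f : Finset.powersetCard u S × Finset.powersetCard (n - s - u) Sᶜ →
      {N : PosSet n s // weightN N e = u} := fun x =>
    ⟨⟨x.1.1 ∪ x.2.1, by
      obtain ⟨h0, -, -, h1, h2⟩ := hmem x
      rw [Finset.card_union_of_disjoint h0, h1, h2]; omega⟩, by
      have h : (x.1.1 ∪ x.2.1).filter (fun i => e i ≠ 0) = (x.1.1 ∪ x.2.1) ∩ S := by
        ext i; simp [S]
      refine Eq.trans ?_ (hmem x).2.2.2.1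
      unfold weightN
      convert congrArg Finset.card (h.trans (hinter x).1)⟩
  have hf : Function.Injective f := fun x y hxy => by
    have h : x.1.1 ∪ x.2.1 = y.1.1 ∪ y.2.1 :=
      congrArg (fun z : {N : PosSet n s // weightN N e = u} => z.1.1) hxy
    refine Prod.ext (Subtype.ext ?_) (Subtype.ext ?_)
    · rw [← (hinter x).1, h, (hinter y).1]
    · rw [← (hinter x).2, h, (hinter y).2]
  refine le_trans (le_of_eq ?_) (Nat.card_le_card_of_injective f hf)
  rw [Nat.card_prod, Nat.card_eq_fintype_card, Nat.card_eq_fintype_card, Fintype.card_coe,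
    Fintype.card_coe, Finset.card_powersetCard, Finset.card_powersetCard, Finset.card_compl, hS,
    Fintype.card_fin]

/-- Both sides count the ways to cut a set of `u + a + b + d` elements into parts of sizes
`u`, `a`, `b`, `d`. -/
theorem choose_mul_choose_mul_choose_eq (u a b d : ℕ) :
    (u + a + b + d).choose (u + a) * ((u + a).choose u * (b + d).choose b) =
      (u + a + b + d).choose (u + b) * ((a + d).choose a * (u + b).choose u) := by
  have key : ∀ i j : ℕ, (i + j).choose i * i.factorial * j.factorial = (i + j).factorial :=
    fun i j => by rw [Nat.choose_symm_add, Nat.add_choose_mul_factorial_mul_factorial]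
  have e1 := key (u + a) (b + d)
  have e2 := key u a
  have e3 := key b d
  have e4 := key (u + b) (a + d)
  have e5 := key u b
  have e6 := key a d
  rw [show u + a + (b + d) = u + a + b + d by ring] at e1
  rw [show u + b + (a + d) = u + a + b + d by ring] at e4
  have hpos : 0 < u.factorial * a.factorial * (b.factorial * d.factorial) := by positivity
  refine Nat.eq_of_mul_eq_mul_right hpos ?_
  calc _ = (u + a + b + d).choose (u + a) * ((u + a).choose u * u.factorial * a.factorial) *
        ((b + d).choose b * b.factorial * d.factorial) := by ring
    _ = (u + a + b + d).choose (u + b) * ((u + b).choose u * u.factorial * b.factorial) *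
        ((a + d).choose a * a.factorial * d.factorial) := by rw [e2, e3, e5, e6, e1, e4]
    _ = _ := by ring

/-- The probability that a random `𝒩` splits the error as expected. -/
theorem inv_expIter_le_prob {n : ℕ} {q : Params} (hq : Admissible n q) {e : Vec n}
    (he : hammingNorm e = q.t) :
    (expIter n q)⁻¹ ≤ prob (PosSet n q.s) (fun N => weightN N e = q.u) := by
  obtain ⟨-, hsk, hkn, hut, htu, hun⟩ := hq
  have hsn := hsk.trans hkn
  have hcard := choose_mul_choose_le_card hsn hun e
  rw [he] at hcard
  obtain ⟨a, ha⟩ := Nat.exists_eq_add_of_le hut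
  obtain ⟨b, hb⟩ := Nat.exists_eq_add_of_le hun
  obtain ⟨d, hd⟩ := Nat.exists_eq_add_of_le htu
  have hta : q.t - q.u = a := by omega
  have hn : n = q.u + a + b + d := by omega
  have h1 : n - q.s - q.u = b := by omega
  have h2 : n - q.t = b + d := by omega
  have h3 : q.s = a + d := by omega
  have hid := choose_mul_choose_mul_choose_eq q.u a b d
  rw [← hn, ← ha, ← h3, ← h2, ← hb, ← h1] at hid
  have hA : (0 : ℝ) < n.choose q.t := by
    exact_mod_cast Nat.choose_pos (show q.t ≤ n by omega)
  have hB : (0 : ℝ) < n.choose (n - q.s) := by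
    exact_mod_cast Nat.choose_pos (Nat.sub_le n q.s)
  rw [expIter, inv_div, prob, card_posSet_eq hsn, div_le_div_iff₀ hA hB, hta]
  have hid' : (n.choose q.t : ℝ) * ((q.t).choose q.u * (n - q.t).choose (n - q.s - q.u)) =
      n.choose (n - q.s) * ((q.s).choose a * (n - q.s).choose q.u) := by exact_mod_cast hid
  rw [mul_comm, ← hid', mul_comm]
  refine mul_le_mul_of_nonneg_right ?_ hA.le
  exact_mod_cast hcard

/-! ### Repeating the iterations -/

theorem one_sub_pow_le_exp {p : ℝ} (hp : p ≤ 1) (m : ℕ) : (1 - p) ^ m ≤ Real.exp (-(m * p)) := by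
  have h : 1 - p ≤ Real.exp (-p) := by
    have := Real.add_one_le_exp (-p)
    linarith
  refine (pow_le_pow_left₀ (by linarith) h m).trans (le_of_eq ?_)
  rw [← Real.exp_nat_mul]
  congr 1; ring

/-- Independent iterations share a random instance `C`. Each draws an element `N` which is good with
probability at least `g`, and succeeds with probability at least `1 - η` on average over `C` when
`N` is good. By Markov's inequality most instances have a success probability of at least `g / 2`
in each iteration. -/
theorem one_sub_le_prob_exists_iteration {Ω₁ Ω₂ Ω₃ : Type} [Fintype Ω₁] [Fintype Ω₂] [Fintype Ω₃]
    [Nonempty Ω₁] [Nonempty Ω₂] [Nonempty Ω₃] (good : Ω₂ → Prop) (ok : Ω₁ → Ω₂ → Ω₃ → Prop) (m : ℕ)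
    {η g : ℝ} (hg0 : 0 < g) (hg : g ≤ prob Ω₂ good)
    (hη : ∀ N, good N → prob (Ω₁ × Ω₃) (fun x => ¬ok x.1 N x.2) ≤ η) :
    1 - (2 * η + Real.exp (-(m * g / 2))) ≤ prob (Ω₁ × (Fin m → Ω₂ × Ω₃))
      (fun ω => ∃ i, good (ω.2 i).1 ∧ ok ω.1 (ω.2 i).1 (ω.2 i).2) := by
  set γ := prob Ω₂ good with hγ
  have hγ0 : 0 < γ := hg0.trans_le hg
  let F : Ω₁ → ℝ := fun C => prob (Ω₂ × Ω₃) (fun ρ => good ρ.1 ∧ ¬ok C ρ.1 ρ.2)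
  let p : Ω₁ → ℝ := fun C => prob (Ω₂ × Ω₃) (fun ρ => good ρ.1 ∧ ok C ρ.1 ρ.2)
  have hpF : ∀ C, γ ≤ p C + F C := fun C => by
    refine le_trans ?_ (prob_or_le _ _)
    rw [hγ, ← prob_fst (Ω' := Ω₃) good]
    exact prob_mono fun ρ hρ => by tauto
  have hEF : 𝔼 C, F C ≤ γ * η := by
    have h1 : ∀ C, F C = 𝔼 N, ind (good N) * prob Ω₃ (fun A => ¬ok C N A) := fun C => by
      simp only [F, prob_prod]
      refine Finset.expect_congr rfl fun N _ => ?_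
      simp only [prob_eq_expect, ind_and, Finset.mul_expect]
    simp only [h1]
    rw [Finset.expect_comm, hγ, prob_eq_expect, Finset.expect_mul]
    refine Finset.expect_le_expect fun N _ => ?_
    rw [← Finset.mul_expect]
    by_cases hN : good N
    · rw [ind_of hN, one_mul, one_mul]
      have := hη N hN
      rwa [prob_prod] at this
    · rw [ind_of_not hN, zero_mul, zero_mul]
  have hfail : ∀ C, prob (Fin m → Ω₂ × Ω₃)
      (fun f => ¬∃ i, good (f i).1 ∧ ok C (f i).1 (f i).2) ≤
      Real.exp (-(m * g / 2)) + F C * (2 / γ) := fun C => by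
    have h1 : prob (Fin m → Ω₂ × Ω₃) (fun f => ¬∃ i, good (f i).1 ∧ ok C (f i).1 (f i).2) =
        (1 - p C) ^ m := by
      rw [prob_congr fun f => not_exists, prob_pi_forall
        (fun ρ : Ω₂ × Ω₃ => ¬(good ρ.1 ∧ ok C ρ.1 ρ.2)), prob_not, Fintype.card_fin]
    have hF0 : 0 ≤ F C * (2 / γ) := mul_nonneg (prob_nonneg _) (by positivity)
    by_cases hFC : F C ≤ γ / 2
    · rw [h1]
      refine ((one_sub_pow_le_exp (prob_le_one _) m).trans (Real.exp_le_exp.mpr ?_)).trans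
        (le_add_of_nonneg_right hF0)
      have h2 : g / 2 ≤ p C := by linarith [hpF C]
      have := mul_le_mul_of_nonneg_left h2 (Nat.cast_nonneg (α := ℝ) m)
      linarith
    · refine (prob_le_one _).trans ?_
      have h3 : 1 ≤ F C * (2 / γ) := by
        rw [mul_div_assoc', le_div_iff₀ hγ0]; linarith
      linarith [Real.exp_pos (-(m * g / 2))]
  have htotal : prob (Ω₁ × (Fin m → Ω₂ × Ω₃))
      (fun ω => ¬∃ i, good (ω.2 i).1 ∧ ok ω.1 (ω.2 i).1 (ω.2 i).2) ≤
      2 * η + Real.exp (-(m * g / 2)) := by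
    rw [prob_prod]
    refine (Finset.expect_le_expect fun C _ => hfail C).trans ?_
    rw [Finset.expect_add_distrib, Fintype.expect_const, ← Finset.expect_mul]
    have h4 := mul_le_mul_of_nonneg_right hEF (show 0 ≤ 2 / γ by positivity)
    have h5 : γ * η * (2 / γ) = 2 * η := by field_simp
    linarith
  rw [prob_not] at htotal
  linarith

/-! ### Success of the decoder for a given length -/

theorem hammingNorm_restrictP_of_weightN {n s t u : ℕ} {N : PosSet n s} {e : Vec n}
    (he : hammingNorm e = t) (hN : weightN N e = u) : hammingNorm (restrictP N e) = t - u := by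
  rw [← he, ← hN, weightN_eq, hammingNorm_split N e]
  omega

theorem expIter_pos {n : ℕ} {q : Params} (hq : Admissible n q) : 0 < expIter n q := by
  obtain ⟨-, hsk, hkn, hut, htu, hun⟩ := hq
  have h1 : 0 < n.choose q.t := Nat.choose_pos (by omega)
  have h2 : 0 < q.s.choose (q.t - q.u) := Nat.choose_pos htu
  have h3 : 0 < (n - q.s).choose q.u := Nat.choose_pos hun
  unfold expIter
  positivity

theorem one_sub_le_prob_exists_iterOk {n : ℕ} {q : Params} (hq : Admissible n q)
    (hδ : 0 < delta n q) {e : Vec n} (he : hammingNorm e = q.t) (R : PosSet n q.s → Vec n → Prop)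
    {cnt : ℝ} (hR : ∀ N, weightN N e = q.u → ∑ x, ind (R N x) = cnt) :
    1 - (2 * (q.nAux * (80 * errTerm n q) + cnt / 2 ^ (n - q.k)) +
        Real.exp (-(q.nIter * (expIter n q)⁻¹ / 2))) ≤
      prob (Run n q) (fun ω => ∃ i, weightN (ω.2 i).1 e = q.u ∧
        IterOk q hq.2.2.1 e R ω.1 (ω.2 i).1 (ω.2 i).2) := by
  have := nonempty_code hq.2.2.1
  have := nonempty_code hq.1
  have := nonempty_posSet (hq.2.1.trans hq.2.2.1)
  refine one_sub_le_prob_exists_iteration (fun N : PosSet n q.s => weightN N e = q.u)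
    (fun C N A => IterOk q hq.2.2.1 e R C N A) q.nIter (inv_pos.mpr (expIter_pos hq))
    (inv_expIter_le_prob hq he) fun N hN => ?_
  rw [← hR N hN]
  exact prob_not_iterOk_le hq hδ hN (hammingNorm_restrictP_of_weightN he hN) R

theorem findSome?_eq_some {α β : Type*} {l : List α} {f : α → Option β} {b : β}
    (hall : ∀ a ∈ l, f a = none ∨ f a = some b) (hex : ∃ a ∈ l, f a = some b) :
    l.findSome? f = some b := by
  induction l with
  | nil => simp at hex
  | cons a l ih =>
    rw [List.findSome?_cons]
    rcases hall a (by simp) with h | h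
    · rw [h]
      refine ih (fun x hx => hall x (by simp [hx])) ?_
      obtain ⟨x, hx, hxb⟩ := hex
      rcases List.mem_cons.mp hx with rfl | hx
      · rw [h] at hxb; cases hxb
      · exact ⟨x, hx, hxb⟩
    · rw [h]

theorem decoderOutput_eq_some {n : ℕ} {q : Params} (hut : q.u ≤ q.t) {c₀ e : Vec n} {ω : Run n q}
    (hc₀ : c₀ ∈ ω.1.1) (huniq : ¬∃ x, hammingNorm x = q.t ∧ x ≠ e ∧ e - x ∈ ω.1.1)
    (hfound : ∃ i, e ∈ foundErrors q (c₀ + e) ω.1 (ω.2 i)) :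
    decoderOutput q (c₀ + e) ω = some e := by
  have hall : ∀ i, ∀ x ∈ foundErrors q (c₀ + e) ω.1 (ω.2 i), x = e := fun i x hx => by
    obtain ⟨h1, h2, h3⟩ := of_mem_foundErrors hx
    by_contra hne
    refine huniq ⟨x, ?_, hne, (add_sub_mem_iff hc₀).mp h1⟩
    rw [hammingNorm_split (ω.2 i).1, h2, ← weightN_eq, h3]
    omega
  refine findSome?_eq_some (fun i _ => ?_) ?_
  · rcases hl : foundErrors q (c₀ + e) ω.1 (ω.2 i) with _ | ⟨x, l⟩
    · left; rw [recoverE, hl]; rfl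
    · right; rw [recoverE, hl, List.head?_cons, hall i x (by simp [hl])]
  · obtain ⟨i, hi⟩ := hfound
    exact ⟨i, List.mem_finRange i, head?_eq_some_of_forall_eq hi (hall i)⟩

/-! ### Asymptotics -/

theorem tendsto_errTerm {p : ℕ → Params} (hδ : ∀ᶠ n in atTop, 0 < delta n (p n))
    (h : ParameterConstraint p) : Tendsto (fun n => errTerm n (p n)) atTop (𝓝 0) := by
  obtain ⟨α, hα, hω, h1, h2⟩ := h
  obtain ⟨K₁, hK₁⟩ := h1.bound
  obtain ⟨K₂, hK₂⟩ := h2.bound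
  have hlim := (tendsto_const_nhds (x := K₁ + K₂ + 1)).div_atTop hω
  refine squeeze_zero' (hδ.mono fun n hn => (errTerm_pos hn).le) ?_ hlim
  filter_upwards [hδ, hK₁, hK₂, eventually_ge_atTop 1] with n hδ hK₁ hK₂ hn
  have hn1 : (1 : ℝ) ≤ n := by exact_mod_cast hn
  have hH := expSamples_pos hδ
  have hnα : (1 : ℝ) ≤ (n : ℝ) ^ α := Real.one_le_rpow hn1 hα.le
  have hnα8 : (n : ℝ) ^ α ≤ (n : ℝ) ^ (α + 8) :=
    Real.rpow_le_rpow_of_exponent_le hn1 (by linarith)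
  have hδH : 0 < delta n (p n) ^ 2 * expSamples n (p n) := mul_pos (pow_pos hδ 2) hH
  rw [Real.norm_of_nonneg (by positivity), Real.norm_of_nonneg (by positivity)] at hK₁ hK₂
  have hKK : 0 ≤ K₁ + K₂ := by
    have h3 : 0 ≤ K₁ * (n : ℝ) ^ α := le_trans (by positivity) hK₁
    have h4 : 0 ≤ K₂ * (n : ℝ) ^ α := le_trans (by positivity) hK₂
    have := nonneg_of_mul_nonneg_left h3 (by linarith)
    have := nonneg_of_mul_nonneg_left h4 (by linarith)
    linarith
  have hrhs : (K₁ + K₂ + 1) / (|expSamples n (p n)| / ((n : ℝ) ^ (α + 8) / delta n (p n) ^ 2)) =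
      (K₁ + K₂ + 1) * (n : ℝ) ^ (α + 8) / (delta n (p n) ^ 2 * expSamples n (p n)) := by
    rw [abs_of_pos hH]
    field_simp
  rw [hrhs, errTerm]
  refine div_le_div_of_nonneg_right ?_ hδH.le
  have h5 := mul_le_mul_of_nonneg_left hnα8 (show 0 ≤ K₁ + K₂ + 1 by linarith)
  linarith

theorem tendsto_exp_neg_nIter {p : ℕ → Params} (hIter : IsLittleOmega (fun n => ((p n).nIter : ℝ))
    (fun n => expIter n (p n))) :
    Tendsto (fun n => Real.exp (-((p n).nIter * (expIter n (p n))⁻¹ / 2))) atTop (𝓝 0) := by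
  refine Real.tendsto_exp_neg_atTop_nhds_zero.comp ?_
  refine (hIter.atTop_div_const two_pos).congr fun n => ?_
  rw [abs_of_nonneg (Nat.cast_nonneg _), div_eq_mul_inv ((p n).nIter : ℝ)]

/-- The number `cnt` of vectors that compete with `e` in an iteration may be anything that is
negligible compared to the number of syndromes. -/
theorem tendsto_prob_exists_iterOk {p : ℕ → Params} (hp : ∀ᶠ n in atTop, Admissible n (p n))
    (hδ : ∀ᶠ n in atTop, 0 < delta n (p n)) (hconstraint : ParameterConstraint p)
    (hIter : IsLittleOmega (fun n => ((p n).nIter : ℝ)) (fun n => expIter n (p n)))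
    (hAux : (fun n => ((p n).nAux : ℝ)) =O[atTop] (fun _ => (1 : ℝ)))
    {e : (n : ℕ) → Vec n} (he : ∀ᶠ n in atTop, hammingNorm (e n) = (p n).t)
    (R : (n : ℕ) → PosSet n (p n).s → Vec n → Prop) {cnt : ℕ → ℝ}
    (hR : ∀ n N, weightN N (e n) = (p n).u → ∑ x, ind (R n N x) = cnt n)
    (hcnt : Tendsto (fun n => cnt n / 2 ^ (n - (p n).k)) atTop (𝓝 0))
    {E : (n : ℕ) → Run n (p n) → Prop}
    (hE : ∀ n (hk : (p n).k ≤ n), hammingNorm (e n) = (p n).t → ∀ ω : Run n (p n), ∀ i,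
      weightN (ω.2 i).1 (e n) = (p n).u →
      IterOk (p n) hk (e n) (R n) ω.1 (ω.2 i).1 (ω.2 i).2 → E n ω) :
    Tendsto (fun n => prob (Run n (p n)) (E n)) atTop (𝓝 1) := by
  have herr := tendsto_errTerm hδ hconstraint
  have hunion : Tendsto (fun n => ((p n).nAux : ℝ) * (80 * errTerm n (p n))) atTop (𝓝 0) := by
    refine (hAux.mul (isBigO_refl (fun n => 80 * errTerm n (p n)) atTop)).trans_tendsto ?_
    simpa using herr.const_mul 80
  have hlow := (tendsto_const_nhds (x := (1 : ℝ))).sub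
    (((hunion.add hcnt).const_mul 2).add (tendsto_exp_neg_nIter hIter))
  rw [add_zero, add_zero, mul_zero, sub_zero] at hlow
  refine tendsto_of_tendsto_of_tendsto_of_le_of_le' hlow tendsto_const_nhds ?_
    (Eventually.of_forall fun n => prob_le_one _)
  filter_upwards [hp, hδ, he] with n hq hδ he
  refine (one_sub_le_prob_exists_iterOk hq hδ he (R n) (hR n)).trans (prob_mono fun ω hω => ?_)
  obtain ⟨i, hi, hok⟩ := hω
  exact hE n hq.2.2.1 he ω i hi hok

theorem tendsto_div_two_pow {p : ℕ → Params} (hp : ∀ᶠ n in atTop, Admissible n (p n)) {f : ℕ → ℝ}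
    (hf : f =o[atTop] (fun n : ℕ => (2 : ℝ) ^ ((n : ℤ) - ((p n).k : ℤ)))) :
    Tendsto (fun n => f n / 2 ^ (n - (p n).k)) atTop (𝓝 0) := by
  refine hf.tendsto_div_nhds_zero.congr' ?_
  filter_upwards [hp] with n hq
  rw [← Nat.cast_sub hq.2.2.1, zpow_natCast]

end DoubleRLPN

theorem mainTheorem4
    (p : ℕ → DoubleRLPN.Params)
    (hp : ∀ᶠ n in atTop, DoubleRLPN.Admissible n (p n))
    (hδ : ∀ᶠ n in atTop, 0 < DoubleRLPN.delta n (p n))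
    (hconstraint : DoubleRLPN.ParameterConstraint p)
    (hIter : DoubleRLPN.IsLittleOmega (fun n => ((p n).nIter : ℝ))
      (fun n => DoubleRLPN.expIter n (p n)))
    (hAux : (fun n => ((p n).nAux : ℝ)) =O[atTop] (fun _ => (1 : ℝ)))
    (e : (n : ℕ) → DoubleRLPN.Vec n)
    (he : ∀ᶠ n in atTop, hammingNorm (e n) = (p n).t)
    (c : (n : ℕ) → DoubleRLPN.Code n (p n).k → DoubleRLPN.Vec n)
    (hc : ∀ n C, c n C ∈ C.1) :
    -- the error vector is found
    Tendsto (fun n => DoubleRLPN.prob (DoubleRLPN.Run n (p n)) fun ω =>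
      ∃ i, e n ∈ DoubleRLPN.foundErrors (p n) (c n ω.1 + e n) ω.1 (ω.2 i)) atTop (𝓝 1) ∧
    -- it is returned by some iteration
    ((fun n : ℕ => ((p n).s.choose ((p n).t - (p n).u) : ℝ) * ((n - (p n).s).choose (p n).u : ℝ))
        =o[atTop] (fun n : ℕ => (2 : ℝ) ^ ((n : ℤ) - ((p n).k : ℤ))) →
      Tendsto (fun n => DoubleRLPN.prob (DoubleRLPN.Run n (p n)) fun ω =>
        ∃ i, DoubleRLPN.recoverE (p n) (c n ω.1 + e n) ω.1 (ω.2 i) = some (e n))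
        atTop (𝓝 1)) ∧
    -- it is the first vector returned by the decoder
    ((fun n : ℕ => (n.choose (p n).t : ℝ)) =o[atTop] (fun n : ℕ => (2 : ℝ) ^ ((n : ℤ) - ((p n).k : ℤ))) →
      Tendsto (fun n => DoubleRLPN.prob (DoubleRLPN.Run n (p n)) fun ω =>
        DoubleRLPN.decoderOutput (p n) (c n ω.1 + e n) ω = some (e n))
        atTop (𝓝 1)) := by
  open DoubleRLPN in
  have hfound : Tendsto (fun n => prob (Run n (p n)) fun ω =>
      ∃ i, e n ∈ foundErrors (p n) (c n ω.1 + e n) ω.1 (ω.2 i)) atTop (𝓝 1) := by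
    refine tendsto_prob_exists_iterOk hp hδ hconstraint hIter hAux he
      (fun n N x => restrictP N x = restrictP N (e n) ∧ weightN N x = (p n).u)
      (cnt := fun n => ((n - (p n).s).choose (p n).u : ℝ))
      (fun n N _ => sum_ind_restrictP_eq N (e n) _) ?_ fun n hk hn ω i hi hok => ?_
    · refine squeeze_zero' (Eventually.of_forall fun n => by positivity) ?_
        (tendsto_errTerm hδ hconstraint)
      filter_upwards [hp, hδ] with n hq hδ
      rw [div_le_iff₀ (by positivity)]
      exact choose_le_errTerm_mul hq hδ
    · exact ⟨i, mem_foundErrors hk (hc n ω.1) (fun x h1 h2 => ⟨h1, h2⟩) hi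
        (hammingNorm_restrictP_of_weightN hn hi) hok⟩
  refine ⟨hfound, fun hfew => ?_, fun hfew => ?_⟩
  · open DoubleRLPN in
    refine tendsto_prob_exists_iterOk hp hδ hconstraint hIter hAux he
      (fun n N x => hammingNorm (restrictP N x) = (p n).t - (p n).u ∧ weightN N x = (p n).u)
      (fun n N _ => sum_ind_hammingNorm_restrictP N _ _) (tendsto_div_two_pow hp hfew)
      fun n hk hn ω i hi hok => ?_
    have hP := hammingNorm_restrictP_of_weightN hn hi
    refine ⟨i, head?_eq_some_of_forall_eq (mem_foundErrors hk (hc n ω.1)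
      (fun x h1 h2 => ⟨by rw [h1, hP], h2⟩) hi hP hok) fun x hx => ?_⟩
    obtain ⟨h1, h2, h3⟩ := of_mem_foundErrors hx
    exact hok.2 x ⟨h2, h3⟩ ((add_sub_mem_iff (hc n ω.1)).mp h1)
  · have hlow := hfound.sub (DoubleRLPN.tendsto_div_two_pow hp hfew)
    rw [sub_zero] at hlow
    refine tendsto_of_tendsto_of_tendsto_of_le_of_le' hlow tendsto_const_nhds ?_
      (Eventually.of_forall fun n => DoubleRLPN.prob_le_one _)
    open DoubleRLPN in
    filter_upwards [hp] with n hq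
    have := nonempty_code hq.1
    have := nonempty_posSet (hq.2.1.trans hq.2.2.1)
    have hother := (prob_fst (Ω' := Fin (p n).nIter → Iter n (p n)) _).trans_le
      (prob_exists_solution_le hq.2.2.1 (e n) (fun x => hammingNorm x = (p n).t))
    rw [sum_sphere] at hother
    rw [sub_le_iff_le_add]
    refine (prob_mono fun ω hω => ?_).trans ((prob_or_le _ _).trans (add_le_add_right hother _))
    by_contra! hcon
    refine hcon.1 (decoderOutput_eq_some hq.2.2.2.1 (hc n ω.1) ?_ hω)
    rintro ⟨x, hx, hxe, hxC⟩
    exact hcon.2 x hx hxe hxC
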